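/- **Theorem (GFT approximation via profit).** Consider a market with $m$ buyers and $n$ sellers ($m,n\ge 0$). Buyer $i$ has a private value $v_i\ge 0$ drawn from a probability distribution $D_i$, seller $j$ has a private cost $c_j\ge 0$ drawn from a probability distribution $F_j$, and all values and costs are mutually independent; the distributions are otherwise arbitrary. Let $E\subseteq[m]\times[n]$, and let $\mathcal F\subseteq 2^{E}$ be a family of matchings of the bipartite graph $E$ (the feasible matchings) with $\varnothing\in\mathcal F$ that is downward-closed: $M'\subseteq M\in\mathcal F$ implies $M'\in\mathcal F$. Put $$\mathtt{GFT}^*=\mathbb E_{\mathbf v,\mathbf c}\Big[\max_{M\in\mathcal F}\sum_{(i,j)\in M}(v_i-c_j)\Big]\in[0,\infty].$$ A mechanism maps bids $(\mathbf b,\mathbf s)\in[0,\infty)^m\times[0,\infty)^n$ measurably to an allocation $\mathbf x(\mathbf b,\mathbf s)\in[0,1]^{m\times n}$ in the convex hull of the indicator matrices of the matchings in $\mathcal F$ (a lottery over feasible matchings), payments $p^b_i(\mathbf b,\mathbf s)\ge 0$ charged to the buyers and payments $p^s_j(\mathbf b,\mathbf s)\ge 0$ paid to the sellers. The utilities are $v_i\sum_j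 x_{ij}-p^b_i$ for buyer $i$ and $p^s_j-c_j\sum_i x_{ij}$ for seller $j$. The mechanism is BIC for one side of the market if every agent of that side, whatever her type, maximizes by truthful reporting her expected utility over the types of all other agents, who report truthfully; it is ex-post IR for that side if a truthful agent of that side has nonnegative utility at all reports of the others. Let $\Pi_S(\mathrm{GSOM})$ be the optimal total expected sellers' profit, that is, the supremum of $\mathbb E_{\mathbf v,\mathbf c}\big[\sum_i p^b_i-\sum_{i,j}c_jx_{ij}\big]$ over all mechanisms that are BIC and ex-post IR for the buyers. Let $\Pi_B(\mathrm{GBOM})$ be the optimal total expected buyers' profit, that is, the supremum of $\mathbb E_{\mathbf v,\mathbf c}\big[\sum_{i,j}v_ix_{ij}-\sum_j p^s_j\big]$ over all mechanisms that are BIC and ex-post IR for the sellers. (Expectations take values in $[-\infty,\infty]$, with the value $-\infty$ where the positive and the negative part both have infinite expectation.) Then $$\tfrac12\,\Pi_S(\mathrm{GSOM})+\tfrac12\,\Pi_B(\mathrm{GBOM})\ \ge\ \frac{1}{3.15}\,\mathtt{GFT}^*.$$ In particular, if the two suprema are attained, the inequality holds for the sellers' profit of any mechanism GSOM attaining the first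 and the buyers' profit of any mechanism GBOM attaining the second. -/

import Mathlib

open MeasureTheory
open scoped NNReal ENNReal

noncomputable section

/-- The expectation of a real random variable as an extended real number: the integral of its
positive part minus the integral of its negative part. It is the usual integral if `f` is
integrable, and it is `⊥` if the integral of the negative part is infinite (in particular if both
integrals are infinite). -/
def extExpectation {Ω : Type*} [MeasurableSpace Ω] (μ : Measure Ω) (f : Ω → ℝ) : EReal :=
  ((∫⁻ ω, ENNReal.ofReal (f ω) ∂μ : ℝ≥0∞) : EReal) -
    ((∫⁻ ω, ENNReal.ofReal (-f ω) ∂μ : ℝ≥0∞) : EReal)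

/-- A Bayesian single-dimensional matching market with `m` unit-demand buyers and `n` unit-supply
sellers. Values and costs are nonnegative; buyer `i` has value distribution `D i` and seller `j`
has cost distribution `F j`. -/
structure MatchingMarket (m n : ℕ) where
  /-- the value distributions of the buyers -/
  D : Fin m → ProbabilityMeasure ℝ≥0
  /-- the cost distributions of the sellers -/
  F : Fin n → ProbabilityMeasure ℝ≥0
  /-- the possible trading pairs -/
  edges : Finset (Fin m × Fin n)
  /-- the family of feasible matchings -/
  feasible : Finset (Finset (Fin m × Fin n))
  subset_edges : ∀ A ∈ feasible, A ⊆ edges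
  empty_mem : ∅ ∈ feasible
  is_matching : ∀ A ∈ feasible, ∀ e ∈ A, ∀ e' ∈ A, e.1 = e'.1 ∨ e.2 = e'.2 → e = e'
  downward_closed : ∀ A ∈ feasible, ∀ A' ⊆ A, A' ∈ feasible

namespace MatchingMarket

variable {m n : ℕ}

/-- The joint distribution of all values and all costs, which are mutually independent. -/
def law (K : MatchingMarket m n) : Measure ((Fin m → ℝ≥0) × (Fin n → ℝ≥0)) :=
  (Measure.pi fun i => (K.D i : Measure ℝ≥0)).prod (Measure.pi fun j => (K.F j : Measure ℝ≥0))

/-- The gains-from-trade of a set of trades `A` at values `v` and costs `c`. -/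
def gft (A : Finset (Fin m × Fin n)) (v : Fin m → ℝ≥0) (c : Fin n → ℝ≥0) : ℝ :=
  ∑ e ∈ A, ((v e.1 : ℝ) - (c e.2 : ℝ))

/-- The first-best expected gains-from-trade: the expectation of the largest gains-from-trade of
a feasible matching. -/
def firstBest (K : MatchingMarket m n) : EReal :=
  extExpectation K.law fun r => K.feasible.sup' ⟨∅, K.empty_mem⟩ fun A => gft A r.1 r.2

/-- The indicator matrix of a set of trades. -/
def allocOf (A : Finset (Fin m × Fin n)) : Fin m → Fin n → ℝ :=
  fun i j => if (i, j) ∈ A then 1 else 0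

/-- A (direct revelation, possibly randomized) mechanism: given the bids `b` of the buyers and
the bids `s` of the sellers it returns an allocation, the payments charged to the buyers and the
payments paid to the sellers. The allocation is a lottery over feasible matchings; the entry
`alloc b s i j` is the probability that `i` receives the item of `j`. -/
structure Mechanism (K : MatchingMarket m n) where
  alloc : (Fin m → ℝ≥0) → (Fin n → ℝ≥0) → Fin m → Fin n → ℝ
  payB : (Fin m → ℝ≥0) → (Fin n → ℝ≥0) → Fin m → ℝ≥0
  payS : (Fin m → ℝ≥0) → (Fin n → ℝ≥0) → Fin n → ℝ≥0
  alloc_mem : ∀ b s, alloc b s ∈ convexHull ℝ (allocOf '' (K.feasible : Set _))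
  measurable_alloc :
    Measurable fun r : (Fin m → ℝ≥0) × (Fin n → ℝ≥0) => alloc r.1 r.2
  measurable_payB :
    Measurable fun r : (Fin m → ℝ≥0) × (Fin n → ℝ≥0) => payB r.1 r.2
  measurable_payS :
    Measurable fun r : (Fin m → ℝ≥0) × (Fin n → ℝ≥0) => payS r.1 r.2

namespace Mechanism

variable {K : MatchingMarket m n}

/-- The utility of buyer `i` with true value `t` at the reports `b`, `s`. -/
def utilityB (X : Mechanism K) (i : Fin m) (t : ℝ≥0) (b : Fin m → ℝ≥0) (s : Fin n → ℝ≥0) : ℝ :=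
  (t : ℝ) * (∑ j, X.alloc b s i j) - (X.payB b s i : ℝ)

/-- The utility of seller `j` with true cost `t` at the reports `b`, `s`. -/
def utilityS (X : Mechanism K) (j : Fin n) (t : ℝ≥0) (b : Fin m → ℝ≥0) (s : Fin n → ℝ≥0) : ℝ :=
  (X.payS b s j : ℝ) - (t : ℝ) * (∑ i, X.alloc b s i j)

/-- Bayesian incentive compatibility for the buyers: a buyer `i` with value `t` cannot gain in
expectation over all values and costs other than her own by reporting `t'`. (The coordinate `i`
is overwritten, so integrating over it as well changes nothing.) -/
def BICB (X : Mechanism K) : Prop :=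
  ∀ (i : Fin m) (t t' : ℝ≥0),
    extExpectation K.law (fun r => X.utilityB i t (Function.update r.1 i t') r.2) ≤
      extExpectation K.law (fun r => X.utilityB i t (Function.update r.1 i t) r.2)

/-- Bayesian incentive compatibility for the sellers. -/
def BICS (X : Mechanism K) : Prop :=
  ∀ (j : Fin n) (t t' : ℝ≥0),
    extExpectation K.law (fun r => X.utilityS j t r.1 (Function.update r.2 j t')) ≤
      extExpectation K.law (fun r => X.utilityS j t r.1 (Function.update r.2 j t))

/-- Ex-post individual rationality for the buyers. -/
def IRB (X : Mechanism K) : Prop :=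
  ∀ (i : Fin m) (b : Fin m → ℝ≥0) (s : Fin n → ℝ≥0), 0 ≤ X.utilityB i (b i) b s

/-- Ex-post individual rationality for the sellers. -/
def IRS (X : Mechanism K) : Prop :=
  ∀ (j : Fin n) (b : Fin m → ℝ≥0) (s : Fin n → ℝ≥0), 0 ≤ X.utilityS j (s j) b s

/-- The total expected profit of the sellers when they run the mechanism and collect the payments
of the buyers: the buyers' payments minus the costs of the items sold. -/
def sellersProfit (X : Mechanism K) : EReal :=
  extExpectation K.law fun r =>
    (∑ i, (X.payB r.1 r.2 i : ℝ)) - ∑ j, (r.2 j : ℝ) * ∑ i, X.alloc r.1 r.2 i j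

/-- The total expected profit of the buyers when they run the mechanism and pay the sellers:
the values of the items bought minus the payments to the sellers. -/
def buyersProfit (X : Mechanism K) : EReal :=
  extExpectation K.law fun r =>
    (∑ i, (r.1 i : ℝ) * ∑ j, X.alloc r.1 r.2 i j) - ∑ j, (X.payS r.1 r.2 j : ℝ)

/-- `X` is a sellers-offering optimum (GSOM): it maximizes the total expected profit of the
sellers among all mechanisms that are BIC and ex-post IR for the buyers. -/
def IsGSOM (X : Mechanism K) : Prop :=
  (X.BICB ∧ X.IRB) ∧
    ∀ Y : Mechanism K, Y.BICB → Y.IRB → Y.sellersProfit ≤ X.sellersProfit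

/-- `X` is a buyers-offering optimum (GBOM): it maximizes the total expected profit of the
buyers among all mechanisms that are BIC and ex-post IR for the sellers. -/
def IsGBOM (X : Mechanism K) : Prop :=
  (X.BICS ∧ X.IRS) ∧
    ∀ Y : Mechanism K, Y.BICS → Y.IRS → Y.buyersProfit ≤ X.buyersProfit

end Mechanism

/-- The optimal total expected sellers' profit. -/
def optSellersProfit (K : MatchingMarket m n) : EReal :=
  sSup {π | ∃ X : Mechanism K, X.BICB ∧ X.IRB ∧ X.sellersProfit = π}

/-- The optimal total expected buyers' profit. -/
def optBuyersProfit (K : MatchingMarket m n) : EReal :=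
  sSup {π | ∃ X : Mechanism K, X.BICS ∧ X.IRS ∧ X.buyersProfit = π}

end MatchingMarket

end

/-!
The proof compares the expected gains from trade, pair by pair, with the profits of explicit
posted-price mechanisms.

Fix a rule that picks a best matching `M(v, c)` for every profile of values and costs
(`MatchingMarket.bestMatching`, ties broken by a fixed order). If `(i, j)` belongs to `M(v, c)`, then
raising `v i` or lowering `c j` does not change `M(v, c)`, and `c j ≤ v i`. So, when all other values
and costs are fixed, the set `R` of pairs (value of `i`, cost of `j`) at which `i` and `j` are matched
is closed under raising the value and lowering the cost, and contains only pairs with nonnegative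
gains.

**Two agents.** Let `D` and `F` be the distributions of the value and the cost, and let
`G = E[(v - c) 1_R]`. Let `S(c)` be the best profit `(p - c) D[p, ∞)` over prices `p` with
`(p, c) ∈ R`, and let `B(v)` be the best profit `(v - p) F[0, p]` over prices `p` with `(v, p) ∈ R`.
Then, for `0 < l < 1`,
`(1 - l) G ≤ E[S] + log (1 / l) E[B]` and `(1 - l) G ≤ E[B] + log (1 / l) E[S]`.
For the first inequality, write the cost as `c(b)` with a uniform quantile `b ∈ (0, 1)`. Call `b`
deep for `v` if `(v, c(b / l)) ∈ R`, and shallow if `(v, c(b)) ∈ R` but `b` is not deep. Since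
`F[0, c(b)] ≥ b`, shallow quantiles gain at most `B(v) / b`; they lie between `l β` and `β` for some
`β`, so that they contribute at most `log (1 / l) B(v)`. For deep quantiles,
`v - c(b) = (v - c(b / l)) + (c(b / l) - c(b))`. The substitution `b ↦ b / l` shows that the first
summand contributes exactly `l G`, and the second one contributes at most `S(c(b))` for every `b`,
because a seller with cost `c(b)` may trade at all prices at which the cost `c(b / l)` trades. This is
`lintegral_gain_le`; the other inequality, `lintegral_gain_le_swap`, follows by exchanging the sides.

**Mechanisms.** Offer to each buyer `i` a price `p` that does not depend on her report but maximizes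
the expected profit; she gets the item that she gets in the best matching for the value `p`, provided
that her value is at least `p`. The resulting trades are part of the best matching, hence feasible,
and truth-telling is optimal at every profile (`MatchingMarket.sellMechanism`). A buyer is matched to
the same seller at all values at which she is matched, so the profit from `i` is the sum over `j` of
the quantities `E[S]` of the pairs `(i, j)`. To have measurable choices, the prices range over
finitely many points of a sequence that is dense and contains all atoms; letting their number grow
yields the suprema (`MatchingMarket.sum_lintegral_iSup_sellScore_le`). Posting prices to the sellers
(`MatchingMarket.buyMechanism`) is analogous.

For `l = 1 / 3`, the bound `log 3 ≤ 1.1` and the sum of the two inequalities over all pairs give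
`4 / 3 * GFT ≤ 2.1 * (Π_S + Π_B)`, which is the claim.
-/

open ProbabilityTheory Set Filter

/-! ### Quantile functions -/

/-- The (lower) quantile function of a measure on the line, on the open unit interval; the value
outside the unit interval is irrelevant and set to `0`. -/
noncomputable def quantile (F : Measure ℝ) (b : ℝ) : ℝ :=
  if b ∈ Ioo (0 : ℝ) 1 then sInf {x | b ≤ cdf F x} else 0

theorem quantile_le_iff (F : Measure ℝ) {b : ℝ} (hb : b ∈ Ioo (0 : ℝ) 1) (x : ℝ) :
    quantile F b ≤ x ↔ b ≤ cdf F x := by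
  rw [quantile, if_pos hb]
  have hne : {x | b ≤ cdf F x}.Nonempty :=
    (((tendsto_cdf_atTop F).eventually (lt_mem_nhds hb.2)).mono fun _ h => le_of_lt h).exists
  have hbdd : BddBelow {x | b ≤ cdf F x} := by
    obtain ⟨y, hy⟩ := ((tendsto_cdf_atBot F).eventually (gt_mem_nhds hb.1)).exists
    refine ⟨y, fun z hz => ?_⟩
    by_contra! hzy
    exact absurd (le_trans hz (monotone_cdf F hzy.le)) (not_le.2 hy)
  constructor
  · intro h
    refine le_trans ?_ (monotone_cdf F h)
    rw [← (cdf F).iInf_Ioi_eq]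
    refine le_ciInf fun r => ?_
    obtain ⟨z, hz, hzr⟩ := (csInf_lt_iff hbdd hne).1 (mem_Ioi.1 r.2)
    exact le_trans hz (monotone_cdf F hzr.le)
  · exact fun h => csInf_le hbdd h

theorem quantile_mono (F : Measure ℝ) {b b' : ℝ} (hb : b ∈ Ioo (0 : ℝ) 1)
    (hb' : b' ∈ Ioo (0 : ℝ) 1) (h : b ≤ b') : quantile F b ≤ quantile F b' :=
  (quantile_le_iff F hb _).2 (h.trans ((quantile_le_iff F hb' _).1 le_rfl))

theorem ofReal_le_measure_Iic_quantile (F : Measure ℝ) [IsProbabilityMeasure F] {b : ℝ}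
    (hb : b ∈ Ioo (0 : ℝ) 1) : ENNReal.ofReal b ≤ F (Iic (quantile F b)) := by
  rw [← ofReal_cdf]
  exact ENNReal.ofReal_le_ofReal ((quantile_le_iff F hb _).1 le_rfl)

theorem measurable_quantile (F : Measure ℝ) : Measurable (quantile F) := by
  refine measurable_of_Iic fun x => ?_
  have : quantile F ⁻¹' Iic x =
      (Ioo 0 1 ∩ Iic (cdf F x)) ∪ ((Ioo 0 1)ᶜ ∩ {_b | (0 : ℝ) ≤ x}) := by
    ext b
    by_cases hb : b ∈ Ioo (0 : ℝ) 1
    · simp only [mem_preimage, mem_Iic, mem_union, mem_inter_iff, hb, true_and, mem_compl_iff,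
        not_true_eq_false, false_and, or_false, quantile_le_iff F hb]
    · simp only [mem_preimage, mem_Iic, mem_union, mem_inter_iff, hb, false_and, mem_compl_iff,
        not_false_eq_true, true_and, false_or, mem_ofPred_eq, quantile, if_false]
  rw [this]
  exact (measurableSet_Ioo.inter measurableSet_Iic).union
    (measurableSet_Ioo.compl.inter (MeasurableSet.const _))

/-- The quantile function transports the uniform distribution to the given distribution. -/
theorem map_quantile (F : Measure ℝ) [IsProbabilityMeasure F] :
    (volume.restrict (Ioo (0 : ℝ) 1)).map (quantile F) = F := by
  have : IsFiniteMeasure ((volume.restrict (Ioo (0 : ℝ) 1)).map (quantile F)) :=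
    Measure.isFiniteMeasure_map _ _
  refine Measure.ext_of_Iic _ _ fun x => ?_
  rw [Measure.map_apply (measurable_quantile F) measurableSet_Iic,
    Measure.restrict_apply (measurable_quantile F measurableSet_Iic), ← ofReal_cdf]
  have h : quantile F ⁻¹' Iic x ∩ Ioo 0 1 = Iic (cdf F x) ∩ Ioo 0 1 := by
    ext b
    simp only [mem_inter_iff, mem_preimage, mem_Iic]
    exact and_congr_left fun hb => quantile_le_iff F hb x
  rw [h]
  refine le_antisymm ?_ ?_
  · calc volume (Iic (cdf F x) ∩ Ioo 0 1) ≤ volume (Ioc 0 (cdf F x)) :=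
        measure_mono fun b (hb : b ∈ Iic (cdf F x) ∩ Ioo 0 1) =>
        (⟨hb.2.1, hb.1⟩ : b ∈ Ioc 0 (cdf F x))
      _ = _ := by simp
  · calc ENNReal.ofReal (cdf F x) = volume (Ioo 0 (cdf F x)) := by simp
      _ ≤ _ := measure_mono fun b (hb : b ∈ Ioo 0 (cdf F x)) =>
        (⟨hb.2.le, hb.1, hb.2.trans_le (cdf_le_one F x)⟩ : b ∈ Iic (cdf F x) ∩ Ioo 0 1)

theorem lintegral_eq_lintegral_quantile (F : Measure ℝ) [IsProbabilityMeasure F] {f : ℝ → ℝ≥0∞}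
    (hf : Measurable f) : ∫⁻ c, f c ∂F = ∫⁻ b in Ioo (0 : ℝ) 1, f (quantile F b) := by
  conv_lhs => rw [← map_quantile F]
  exact lintegral_map hf (measurable_quantile F)

theorem setLIntegral_Ioo_comp_div {l : ℝ} (hl : 0 < l) {f : ℝ → ℝ≥0∞} (hf : Measurable f) :
    ∫⁻ b in Ioo 0 l, f (b / l) = ENNReal.ofReal l * ∫⁻ b in Ioo (0 : ℝ) 1, f b := by
  have h1 : ∫⁻ b in Ioo 0 l, f (b / l) =
      ∫⁻ b, (Ioo (0 : ℝ) 1).indicator f (l⁻¹ * b) := by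
    rw [← lintegral_indicator measurableSet_Ioo]
    refine lintegral_congr fun b => ?_
    have : b ∈ Ioo 0 l ↔ l⁻¹ * b ∈ Ioo (0 : ℝ) 1 := by
      rw [inv_mul_eq_div]
      exact ⟨fun h => ⟨div_pos h.1 hl, (div_lt_one hl).2 h.2⟩,
        fun h => ⟨(div_pos_iff_of_pos_right hl).1 h.1, (div_lt_one hl).1 h.2⟩⟩
    by_cases hb : b ∈ Ioo 0 l
    · rw [indicator_of_mem hb, indicator_of_mem (this.1 hb), inv_mul_eq_div]
    · rw [indicator_of_notMem hb, indicator_of_notMem (fun h => hb (this.2 h))]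
  rw [h1, ← lintegral_map (hf.indicator measurableSet_Ioo) (measurable_const_mul _),
    Real.map_volume_mul_left (inv_ne_zero hl.ne'), lintegral_smul_measure,
    lintegral_indicator measurableSet_Ioo]
  simp [abs_of_pos hl]

theorem setLIntegral_Icc_inv {β l : ℝ} (hβ : 0 < β) (hl : l ∈ Ioo (0 : ℝ) 1) :
    ∫⁻ b in Icc (l * β) β, ENNReal.ofReal b⁻¹ = ENNReal.ofReal (Real.log (1 / l)) := by
  have hlb : 0 < l * β := mul_pos hl.1 hβ
  have hle : l * β ≤ β := by nlinarith [hl.2]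
  have hint : IntervalIntegrable (fun b : ℝ => b⁻¹) volume (l * β) β :=
    intervalIntegral.intervalIntegrable_inv (fun x hx => by
      rw [uIcc_of_le hle] at hx
      exact (hlb.trans_le hx.1).ne') continuousOn_id
  rw [← ofReal_integral_eq_lintegral_ofReal, integral_Icc_eq_integral_Ioc,
    ← intervalIntegral.integral_of_le hle, integral_inv_of_pos hlb hβ]
  · congr 2
    field_simp
  · exact (intervalIntegrable_iff_integrableOn_Icc_of_le hle).1 hint
  · refine (ae_restrict_iff' measurableSet_Icc).2 (Filter.Eventually.of_forall fun b hb => ?_)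
    exact inv_nonneg.2 (hlb.le.trans hb.1)

/-! ### The two-agent inequality -/

/-- Truncation of a real number to `[-N, N]`. -/
def clampAt (N x : ℝ) : ℝ := max (-N) (min x N)

theorem clampAt_sub_le (N : ℝ) {x y : ℝ} (h : x ≤ y) : clampAt N y - clampAt N x ≤ y - x := by
  unfold clampAt
  rcases le_total x N with h1 | h1 <;> rcases le_total y N with h2 | h2 <;>
    simp only [h1, h2, min_eq_left, min_eq_right] <;>
    rcases max_cases (-N) x with h3 | h3 <;> rcases max_cases (-N) y with h4 | h4 <;>
    rcases max_cases (-N) N with h5 | h5 <;> linarith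

theorem measurable_clampAt (N : ℝ) : Measurable (clampAt N) :=
  measurable_const.max (measurable_id.min measurable_const)

theorem clampAt_sub_le_two_mul {N : ℝ} (hN : 0 ≤ N) (x y : ℝ) :
    clampAt N y - clampAt N x ≤ 2 * N := by
  have h1 : clampAt N y ≤ N := max_le (by linarith) (min_le_right _ _)
  have h2 : -N ≤ clampAt N x := le_max_left _ _
  linarith

theorem clampAt_of_abs_le {N x : ℝ} (h : |x| ≤ N) : clampAt N x = x := by
  rw [clampAt, min_eq_left (abs_le.1 h).2, max_eq_right (abs_le.1 h).1]

/-- A region of trading pairs `(value, cost)`: it is closed under raising the value and lowering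
the cost, and it contains only pairs with nonnegative gains from trade. -/
structure IsTradeRegion (R : Set (ℝ × ℝ)) : Prop where
  measurableSet : MeasurableSet R
  closed : ∀ {v v' c c' : ℝ}, (v, c) ∈ R → v ≤ v' → c' ≤ c → (v', c') ∈ R
  cost_le : ∀ {v c : ℝ}, (v, c) ∈ R → c ≤ v

section core

variable {D F : Measure ℝ} {R : Set (ℝ × ℝ)}
  {S B : ℝ → ℝ≥0∞} {l : ℝ}

/-- The gain, truncated to `[-N, N]`, of the pair formed by the value `p.1` and the cost at the
quantile `p.2` of `F`, if this pair belongs to `R`. -/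
noncomputable def quantileGain (F : Measure ℝ) (R : Set (ℝ × ℝ)) (N : ℝ) (p : ℝ × ℝ) : ℝ≥0∞ :=
  {p : ℝ × ℝ | (p.1, quantile F p.2) ∈ R}.indicator
    (fun p => ENNReal.ofReal (clampAt N p.1 - clampAt N (quantile F p.2))) p

theorem measurableSet_quantile_region (hR : MeasurableSet R) :
    MeasurableSet {p : ℝ × ℝ | (p.1, quantile F p.2) ∈ R} :=
  (measurable_fst.prodMk ((measurable_quantile F).comp measurable_snd)) hR

theorem measurable_quantileGain (hR : MeasurableSet R) (N : ℝ) :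
    Measurable (quantileGain F R N) := by
  refine Measurable.indicator ?_ (measurableSet_quantile_region hR)
  exact (((measurable_clampAt N).comp measurable_fst).sub
    ((measurable_clampAt N).comp ((measurable_quantile F).comp measurable_snd))).ennreal_ofReal

/-- The set of quantiles `b` that trade with value `v` although `b / l` does not. -/
def shallowSet (F : Measure ℝ) (R : Set (ℝ × ℝ)) (l v : ℝ) : Set ℝ :=
  {b | b ∈ Ioo (0 : ℝ) 1 ∧ (v, quantile F b) ∈ R ∧ ¬ (b < l ∧ (v, quantile F (b / l)) ∈ R)}

/-- The shallow quantiles of `v` lie in an interval `[l * β, β]`. -/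
theorem lintegral_shallowSet_inv_le (hR : IsTradeRegion R) (hl : l ∈ Ioo (0 : ℝ) 1) (v : ℝ) :
    ∫⁻ b in shallowSet F R l v, ENNReal.ofReal b⁻¹ ≤ ENNReal.ofReal (Real.log (1 / l)) := by
  -- `T` is an initial segment of `(0, 1)`, so the shallow quantiles are among its last ones
  set T : Set ℝ := {b | b ∈ Ioo (0 : ℝ) 1 ∧ (v, quantile F b) ∈ R} with hT
  by_cases hne : T.Nonempty
  · have hbdd : BddAbove T := ⟨1, fun b hb => hb.1.2.le⟩
    obtain ⟨b₀, hb₀⟩ := hne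
    have hβ : 0 < sSup T := hb₀.1.1.trans_le (le_csSup hbdd hb₀)
    have hβ1 : sSup T ≤ 1 := csSup_le ⟨b₀, hb₀⟩ fun b hb => hb.1.2.le
    rw [← setLIntegral_Icc_inv hβ hl]
    refine lintegral_mono_set ?_
    rintro b ⟨hb, hbR, hbn⟩
    refine ⟨?_, le_csSup hbdd ⟨hb, hbR⟩⟩
    rw [mul_comm, ← le_div_iff₀ hl.1] at *
    by_contra! hlt
    obtain ⟨z, hz, hbz⟩ := exists_lt_of_lt_csSup ⟨b₀, hb₀⟩ hlt
    have hbl : b < l := by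
      have := hbz.trans hz.1.2
      rwa [div_lt_one hl.1] at this
    have hdl : b / l ∈ Ioo (0 : ℝ) 1 := ⟨div_pos hb.1 hl.1, hbz.trans hz.1.2⟩
    exact hbn ⟨hbl, hR.closed hz.2 le_rfl (quantile_mono F hdl hz.1 hbz.le)⟩
  · have : shallowSet F R l v = ∅ :=
      eq_empty_of_forall_notMem fun b hb => hne ⟨b, hb.1, hb.2.1⟩
    simp [this]

theorem measurableSet_shallowSet (hR : MeasurableSet R) :
    MeasurableSet {p : ℝ × ℝ | p.2 ∈ shallowSet F R l p.1} := by
  have h1 := measurableSet_quantile_region (F := F) hR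
  have h2 : MeasurableSet {p : ℝ × ℝ | (p.1, quantile F (p.2 / l)) ∈ R} :=
    (measurable_fst.prodMk
      ((measurable_quantile F).comp (measurable_snd.div_const l))) hR
  have h3 : MeasurableSet {p : ℝ × ℝ | p.2 ∈ Ioo (0 : ℝ) 1} := measurable_snd measurableSet_Ioo
  have h4 : MeasurableSet {p : ℝ × ℝ | p.2 < l} := measurable_snd measurableSet_Iio
  exact h3.inter (h1.inter (h4.inter h2).compl)

/-- The pointwise decomposition of the gain. A quantile `b` that is deep for `v` (the quantile
`b / l` trades as well) is compared with `b / l`; a shallow one is paid for by the buyer. -/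
theorem quantileGain_le [IsProbabilityMeasure F] (hR : IsTradeRegion R) (hl : l ∈ Ioo (0 : ℝ) 1)
    (hB : ∀ v c, (v, c) ∈ R → ENNReal.ofReal (v - c) * F (Iic c) ≤ B v) (N v b : ℝ)
    (hb : b ∈ Ioo (0 : ℝ) 1) :
    quantileGain F R N (v, b) ≤
      (Ioo 0 l).indicator (fun b => quantileGain F R N (v, b / l)) b +
      ((Ioo 0 l).indicator (fun b => ENNReal.ofReal (quantile F (b / l) - quantile F b) *
        {v | (v, quantile F (b / l)) ∈ R}.indicator 1 v) b +
      B v * (shallowSet F R l v).indicator (fun b => ENNReal.ofReal b⁻¹) b) := by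
  by_cases h1 : (v, quantile F b) ∈ R
  swap
  · have : quantileGain F R N (v, b) = 0 :=
      indicator_of_notMem (s := {p : ℝ × ℝ | (p.1, quantile F p.2) ∈ R}) h1 _
    rw [this]
    exact zero_le
  have e1 : quantileGain F R N (v, b) =
      ENNReal.ofReal (clampAt N v - clampAt N (quantile F b)) :=
    indicator_of_mem (s := {p : ℝ × ℝ | (p.1, quantile F p.2) ∈ R}) h1 _
  by_cases h2 : b < l ∧ (v, quantile F (b / l)) ∈ R
  · have hdl : b / l ∈ Ioo (0 : ℝ) 1 := ⟨div_pos hb.1 hl.1, (div_lt_one hl.1).2 h2.1⟩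
    have hbm : b ∈ Ioo 0 l := ⟨hb.1, h2.1⟩
    have hle : quantile F b ≤ quantile F (b / l) :=
      quantile_mono F hb hdl (by rw [le_div_iff₀ hl.1]; nlinarith [hb.1, hl.2])
    have e2 : quantileGain F R N (v, b / l) =
        ENNReal.ofReal (clampAt N v - clampAt N (quantile F (b / l))) :=
      indicator_of_mem (s := {p : ℝ × ℝ | (p.1, quantile F p.2) ∈ R}) h2.2 _
    rw [indicator_of_mem hbm, indicator_of_mem hbm, e1, e2,
      indicator_of_mem (s := {v | (v, quantile F (b / l)) ∈ R}) h2.2, Pi.one_apply, mul_one,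
      ← add_assoc]
    refine le_trans ?_ le_self_add
    refine le_trans (ENNReal.ofReal_le_ofReal ?_) ENNReal.ofReal_add_le
    have := clampAt_sub_le N hle
    linarith
  · have hs : b ∈ shallowSet F R l v := ⟨hb, h1, h2⟩
    rw [indicator_of_mem hs, e1]
    refine le_trans ?_ (le_trans le_add_self le_add_self)
    refine (ENNReal.ofReal_le_ofReal (clampAt_sub_le N (hR.cost_le h1))).trans ?_
    rw [ENNReal.ofReal_inv_of_pos hb.1, ← div_eq_mul_inv,
      ENNReal.le_div_iff_mul_le (Or.inl (by simpa using hb.1)) (Or.inl ENNReal.ofReal_ne_top)]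
    exact (mul_le_mul_right (ofReal_le_measure_Iic_quantile F hb) _).trans (hB _ _ h1)

/-- The truncated form of `lintegral_gain_le`; the truncation makes the integral that appears on
both sides finite. -/
theorem lintegral_quantileGain_le [IsProbabilityMeasure D] [IsProbabilityMeasure F]
    (hR : IsTradeRegion R) (hl : l ∈ Ioo (0 : ℝ) 1)
    (hSm : Measurable S) (hBm : Measurable B)
    (hS : ∀ c c', c ≤ c' → ENNReal.ofReal (c' - c) * D {v | (v, c') ∈ R} ≤ S c)
    (hB : ∀ v c, (v, c) ∈ R → ENNReal.ofReal (v - c) * F (Iic c) ≤ B v) {N : ℝ} (hN : 0 ≤ N) :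
    ENNReal.ofReal (1 - l) *
        ∫⁻ v, (∫⁻ b in Ioo (0 : ℝ) 1, quantileGain F R N (v, b)) ∂D ≤
      ∫⁻ c, S c ∂F + ENNReal.ofReal (Real.log (1 / l)) * ∫⁻ v, B v ∂D := by
  set U : Measure ℝ := volume.restrict (Ioo (0 : ℝ) 1) with hU
  have hgm := measurable_quantileGain (F := F) hR.measurableSet N
  set G := ∫⁻ v, ∫⁻ b, quantileGain F R N (v, b) ∂U ∂D with hG
  have hUu : U univ = 1 := by simp [hU]
  have hfin : G ≠ ⊤ := by
    refine ne_top_of_le_ne_top (b := ENNReal.ofReal (2 * N)) ENNReal.ofReal_ne_top ?_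
    calc G ≤ ∫⁻ _v, ∫⁻ _b, ENNReal.ofReal (2 * N) ∂U ∂D := by
          refine lintegral_mono fun v => lintegral_mono fun b => ?_
          refine (indicator_le_self' (fun _ _ => zero_le) _).trans ?_
          exact ENNReal.ofReal_le_ofReal (clampAt_sub_le_two_mul hN _ _)
      _ = _ := by simp [hUu]
  have hm1 : ∀ v, Measurable fun b =>
      (Ioo 0 l).indicator (fun b => quantileGain F R N (v, b / l)) b := fun v =>
    (hgm.comp (measurable_const.prodMk (measurable_id.div_const l))).indicator measurableSet_Ioo
  have hm2 : Measurable fun p : ℝ × ℝ => (Ioo 0 l).indicator (fun b =>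
      ENNReal.ofReal (quantile F (b / l) - quantile F b) *
        {v | (v, quantile F (b / l)) ∈ R}.indicator 1 p.1) p.2 := by
    have hset : MeasurableSet {p : ℝ × ℝ | (p.1, quantile F (p.2 / l)) ∈ R} :=
      (measurable_fst.prodMk
        ((measurable_quantile F).comp (measurable_snd.div_const l))) hR.measurableSet
    have hq : Measurable fun p : ℝ × ℝ =>
        ENNReal.ofReal (quantile F (p.2 / l) - quantile F p.2) :=
      (((measurable_quantile F).comp (measurable_snd.div_const l)).sub
        ((measurable_quantile F).comp measurable_snd)).ennreal_ofReal
    have := (hq.mul (measurable_one.indicator hset)).indicator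
      (measurable_snd measurableSet_Ioo : MeasurableSet {p : ℝ × ℝ | p.2 ∈ Ioo 0 l})
    exact this
  have hm3 : ∀ v, Measurable fun b =>
      (shallowSet F R l v).indicator (fun b => ENNReal.ofReal b⁻¹) b := fun v =>
    measurable_inv.ennreal_ofReal.indicator
      (measurable_prodMk_left (x := v) (measurableSet_shallowSet (F := F) (l := l)
        hR.measurableSet))
  -- `b ↦ b / l` maps the deep quantiles of `v` onto all quantiles that trade with `v`
  have hpart1 : ∫⁻ v, ∫⁻ b, (Ioo 0 l).indicator (fun b => quantileGain F R N (v, b / l)) b ∂U ∂D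
      = ENNReal.ofReal l * G := by
    rw [hG, ← lintegral_const_mul _ (hgm.lintegral_prod_right')]
    refine lintegral_congr fun v => ?_
    rw [lintegral_indicator measurableSet_Ioo, hU, Measure.restrict_restrict measurableSet_Ioo,
      inter_eq_left.2 (Ioo_subset_Ioo le_rfl hl.2.le)]
    exact setLIntegral_Ioo_comp_div hl.1 (f := fun b => quantileGain F R N (v, b))
      (hgm.comp measurable_prodMk_left)
  have hpart2 : ∫⁻ v, ∫⁻ b, (Ioo 0 l).indicator (fun b =>
      ENNReal.ofReal (quantile F (b / l) - quantile F b) *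
        {v | (v, quantile F (b / l)) ∈ R}.indicator 1 v) b ∂U ∂D ≤ ∫⁻ c, S c ∂F := by
    rw [lintegral_lintegral_swap hm2.aemeasurable, lintegral_eq_lintegral_quantile F hSm]
    refine setLIntegral_mono (hSm.comp (measurable_quantile F)) fun b hb => ?_
    by_cases hbm : b ∈ Ioo 0 l
    · simp only [indicator_of_mem hbm]
      have hms : MeasurableSet {v | (v, quantile F (b / l)) ∈ R} :=
        measurable_prodMk_right hR.measurableSet
      rw [lintegral_const_mul _ (measurable_one.indicator hms), lintegral_indicator_one hms]
      refine hS _ _ (quantile_mono F hb ⟨div_pos hb.1 hl.1, (div_lt_one hl.1).2 hbm.2⟩ ?_)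
      rw [le_div_iff₀ hl.1]
      nlinarith [hb.1, hl.2]
    · simp only [indicator_of_notMem hbm, lintegral_zero]
      exact zero_le
  have hpart3 : ∫⁻ v, ∫⁻ b, B v * (shallowSet F R l v).indicator
      (fun b => ENNReal.ofReal b⁻¹) b ∂U ∂D ≤
        ENNReal.ofReal (Real.log (1 / l)) * ∫⁻ v, B v ∂D := by
    rw [← lintegral_const_mul _ hBm]
    refine lintegral_mono fun v => ?_
    rw [lintegral_const_mul _ (hm3 v), mul_comm]
    refine mul_le_mul_left ?_ _
    calc _ ≤ ∫⁻ b, (shallowSet F R l v).indicator (fun b => ENNReal.ofReal b⁻¹) b :=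
          lintegral_mono' Measure.restrict_le_self le_rfl
      _ = ∫⁻ b in shallowSet F R l v, ENNReal.ofReal b⁻¹ :=
          lintegral_indicator (measurable_prodMk_left (x := v) (measurableSet_shallowSet (F := F)
            (l := l) hR.measurableSet)) _
      _ ≤ _ := lintegral_shallowSet_inv_le hR hl v
  have hmain : G ≤ ENNReal.ofReal l * G +
      (∫⁻ c, S c ∂F + ENNReal.ofReal (Real.log (1 / l)) * ∫⁻ v, B v ∂D) := by
    calc G ≤ ∫⁻ v, ∫⁻ b, ((Ioo 0 l).indicator (fun b => quantileGain F R N (v, b / l)) b +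
          ((Ioo 0 l).indicator (fun b => ENNReal.ofReal (quantile F (b / l) - quantile F b) *
            {v | (v, quantile F (b / l)) ∈ R}.indicator 1 v) b +
          B v * (shallowSet F R l v).indicator (fun b => ENNReal.ofReal b⁻¹) b)) ∂U ∂D := by
          refine lintegral_mono fun v => lintegral_mono_ae ?_
          exact (ae_restrict_iff' measurableSet_Ioo).2 (Eventually.of_forall fun b hb =>
            quantileGain_le hR hl hB N v b hb)
      _ = ∫⁻ v, (∫⁻ b, (Ioo 0 l).indicator (fun b => quantileGain F R N (v, b / l)) b ∂U +
          (∫⁻ b, (Ioo 0 l).indicator (fun b =>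
            ENNReal.ofReal (quantile F (b / l) - quantile F b) *
            {v | (v, quantile F (b / l)) ∈ R}.indicator 1 v) b ∂U +
          ∫⁻ b, B v * (shallowSet F R l v).indicator (fun b => ENNReal.ofReal b⁻¹) b ∂U)) ∂D := by
          refine lintegral_congr fun v => ?_
          have hm2v : Measurable fun b => (Ioo 0 l).indicator (fun b =>
              ENNReal.ofReal (quantile F (b / l) - quantile F b) *
                {v | (v, quantile F (b / l)) ∈ R}.indicator 1 v) b :=
            hm2.comp (measurable_prodMk_left (x := v))
          rw [lintegral_add_left (hm1 v), lintegral_add_left hm2v]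
      _ = _ := by
          rw [lintegral_add_left, lintegral_add_left hm2.lintegral_prod_right', hpart1]
          have : Measurable fun p : ℝ × ℝ =>
              (Ioo 0 l).indicator (fun b => quantileGain F R N (p.1, b / l)) p.2 :=
            (hgm.comp (measurable_fst.prodMk (measurable_snd.div_const l))).indicator
              (measurable_snd measurableSet_Ioo : MeasurableSet {p : ℝ × ℝ | p.2 ∈ Ioo 0 l})
          exact this.lintegral_prod_right'
      _ ≤ _ := by gcongr
  rw [ENNReal.ofReal_sub _ hl.1.le, ENNReal.ofReal_one, ENNReal.sub_mul (fun _ _ => hfin), one_mul]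
  exact tsub_le_iff_left.2 hmain

/-- The two-agent inequality. Here `S c` is at least the profit of a seller with cost `c` who trades
with all values that trade with `c'`, at the price `c'`, and `B v` is at least the profit of a buyer
with value `v` who posts a price at which she may trade. -/
theorem lintegral_gain_le [IsProbabilityMeasure D] [IsProbabilityMeasure F] (hR : IsTradeRegion R) (hl : l ∈ Ioo (0 : ℝ) 1)
    (hSm : Measurable S) (hBm : Measurable B)
    (hS : ∀ c c', c ≤ c' → ENNReal.ofReal (c' - c) * D {v | (v, c') ∈ R} ≤ S c)
    (hB : ∀ v c, (v, c) ∈ R → ENNReal.ofReal (v - c) * F (Iic c) ≤ B v) :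
    ENNReal.ofReal (1 - l) *
        ∫⁻ p, R.indicator (fun p => ENNReal.ofReal (p.1 - p.2)) p ∂(D.prod F) ≤
      ∫⁻ c, S c ∂F + ENNReal.ofReal (Real.log (1 / l)) * ∫⁻ v, B v ∂D := by
  have hm : Measurable (R.indicator fun p : ℝ × ℝ => ENNReal.ofReal (p.1 - p.2)) :=
    (measurable_fst.sub measurable_snd).ennreal_ofReal.indicator hR.measurableSet
  have h1 : ∫⁻ p, R.indicator (fun p => ENNReal.ofReal (p.1 - p.2)) p ∂(D.prod F) =
      ∫⁻ q, R.indicator (fun p => ENNReal.ofReal (p.1 - p.2)) (q.1, quantile F q.2)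
        ∂(D.prod (volume.restrict (Ioo (0 : ℝ) 1))) := by
    rw [lintegral_prod _ hm.aemeasurable, lintegral_prod]
    · refine lintegral_congr fun v => ?_
      exact lintegral_eq_lintegral_quantile F (hm.comp measurable_prodMk_left)
    · exact (hm.comp (measurable_fst.prodMk
        ((measurable_quantile F).comp measurable_snd))).aemeasurable
  rw [h1]
  -- remove the truncation by Fatou's lemma: the truncated gain is eventually the gain
  have hlim : ∀ q : ℝ × ℝ, R.indicator (fun p => ENNReal.ofReal (p.1 - p.2))
      (q.1, quantile F q.2) ≤ liminf (fun N : ℕ => quantileGain F R N q) atTop := by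
    intro q
    refine le_of_eq (Tendsto.liminf_eq ?_).symm
    refine tendsto_const_nhds.congr' ?_
    obtain ⟨N₀, hN₀⟩ := exists_nat_ge (max |q.1| |quantile F q.2|)
    filter_upwards [eventually_ge_atTop N₀] with N hN
    have hN' : max |q.1| |quantile F q.2| ≤ (N : ℝ) := hN₀.trans (by exact_mod_cast hN)
    by_cases hq : (q.1, quantile F q.2) ∈ R
    · rw [indicator_of_mem hq, quantileGain, indicator_of_mem
        (s := {p : ℝ × ℝ | (p.1, quantile F p.2) ∈ R}) hq,
        clampAt_of_abs_le ((le_max_left _ _).trans hN'),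
        clampAt_of_abs_le ((le_max_right _ _).trans hN')]
    · rw [indicator_of_notMem hq, quantileGain, indicator_of_notMem
        (s := {p : ℝ × ℝ | (p.1, quantile F p.2) ∈ R}) hq]
  have hbound : ∀ N : ℕ, ENNReal.ofReal (1 - l) * ∫⁻ q, quantileGain F R N q
      ∂(D.prod (volume.restrict (Ioo (0 : ℝ) 1))) ≤
        ∫⁻ c, S c ∂F + ENNReal.ofReal (Real.log (1 / l)) * ∫⁻ v, B v ∂D := fun N => by
    rw [lintegral_prod _ (measurable_quantileGain hR.measurableSet N).aemeasurable]
    exact lintegral_quantileGain_le hR hl hSm hBm hS hB N.cast_nonneg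
  rw [← lintegral_const_mul' _ _ ENNReal.ofReal_ne_top]
  have hlt : ∀ q : ℝ × ℝ, ENNReal.ofReal (1 - l) *
      R.indicator (fun p => ENNReal.ofReal (p.1 - p.2)) (q.1, quantile F q.2) ≤
        liminf (fun N : ℕ => ENNReal.ofReal (1 - l) * quantileGain F R N q) atTop := fun q => by
    rw [ENNReal.liminf_const_mul_of_ne_top ENNReal.ofReal_ne_top]
    gcongr
    exact hlim q
  refine (lintegral_mono hlt).trans ((lintegral_liminf_le fun N : ℕ =>
    (measurable_quantileGain hR.measurableSet (N : ℝ)).const_mul _).trans ?_)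
  refine liminf_le_of_le (by isBoundedDefault) fun x hx => ?_
  obtain ⟨N, hN⟩ := hx.exists
  refine hN.trans ?_
  rw [lintegral_const_mul' _ _ ENNReal.ofReal_ne_top]
  exact hbound N

end core

/-! ### Exchanging the two sides -/

/-- The two-agent inequality with the roles of the two sides exchanged. It is `lintegral_gain_le`
for the market in which a buyer with value `v` becomes a seller with cost `-v` and a seller with
cost `c` becomes a buyer with value `-c`. -/
theorem lintegral_gain_le_swap {D F : Measure ℝ} [IsProbabilityMeasure D] [IsProbabilityMeasure F]
    {R : Set (ℝ × ℝ)} {S B : ℝ → ℝ≥0∞} {l : ℝ} (hR : IsTradeRegion R) (hl : l ∈ Ioo (0 : ℝ) 1)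
    (hSm : Measurable S) (hBm : Measurable B)
    (hB : ∀ v v', v' ≤ v → ENNReal.ofReal (v - v') * F {c | (v', c) ∈ R} ≤ B v)
    (hS : ∀ v c, (v, c) ∈ R → ENNReal.ofReal (v - c) * D (Ici v) ≤ S c) :
    ENNReal.ofReal (1 - l) *
        ∫⁻ p, R.indicator (fun p => ENNReal.ofReal (p.1 - p.2)) p ∂(D.prod F) ≤
      ∫⁻ v, B v ∂D + ENNReal.ofReal (Real.log (1 / l)) * ∫⁻ c, S c ∂F := by
  have hneg : Measurable (fun x : ℝ => -x) := measurable_neg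
  have : IsProbabilityMeasure (D.map (fun x : ℝ => -x)) :=
    Measure.isProbabilityMeasure_map hneg.aemeasurable
  have : IsProbabilityMeasure (F.map (fun x : ℝ => -x)) :=
    Measure.isProbabilityMeasure_map hneg.aemeasurable
  have hsw : Measurable fun p : ℝ × ℝ => (-p.2, -p.1) :=
    measurable_snd.neg.prodMk measurable_fst.neg
  have hR' : IsTradeRegion {p : ℝ × ℝ | (-p.2, -p.1) ∈ R} :=
    { measurableSet := hsw hR.measurableSet
      closed := fun h h1 h2 => hR.closed h (neg_le_neg h2) (neg_le_neg h1)
      cost_le := fun h => neg_le_neg_iff.1 (hR.cost_le h) }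
  have key := lintegral_gain_le (D := F.map (fun x : ℝ => -x)) (F := D.map (fun x : ℝ => -x))
    (S := fun x => B (-x)) (B := fun x => S (-x)) hR' hl (hBm.comp hneg) (hSm.comp hneg) ?_ ?_
  · have e1 : ∫⁻ c, B (-c) ∂D.map (fun x : ℝ => -x) = ∫⁻ v, B v ∂D := by
      rw [lintegral_map (f := fun c => B (-c)) (hBm.comp hneg) hneg]
      simp only [neg_neg]
    have e2 : ∫⁻ v, S (-v) ∂F.map (fun x : ℝ => -x) = ∫⁻ c, S c ∂F := by
      rw [lintegral_map (f := fun c => S (-c)) (hSm.comp hneg) hneg]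
      simp only [neg_neg]
    rw [e1, e2, ← Measure.prod_swap, Measure.map_prod_map _ _ hneg hneg, Measure.map_map (by fun_prop)
        (by fun_prop), lintegral_map _ (by fun_prop)] at key
    · refine le_trans (le_of_eq ?_) key
      congr 1
      refine lintegral_congr fun p => ?_
      by_cases hp : p ∈ R
      · rw [indicator_of_mem hp, indicator_of_mem
          (s := {p : ℝ × ℝ | (-p.2, -p.1) ∈ R}) (by simpa using hp)]
        simp [add_comm, sub_eq_add_neg]
      · rw [indicator_of_notMem hp, indicator_of_notMem
          (s := {p : ℝ × ℝ | (-p.2, -p.1) ∈ R}) (by simpa using hp)]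
    · exact (measurable_fst.sub measurable_snd).ennreal_ofReal.indicator hR'.measurableSet
  · intro c c' hcc
    have := hB (-c) (-c') (neg_le_neg hcc)
    have hms : MeasurableSet {v : ℝ | (v, c') ∈ {p : ℝ × ℝ | (-p.2, -p.1) ∈ R}} :=
      measurable_prodMk_right hR'.measurableSet
    rw [Measure.map_apply hneg hms]
    convert this using 3
    · ring
    · ext x; simp
  · intro v c h
    have := hS (-c) (-v) h
    rw [Measure.map_apply hneg measurableSet_Iic]
    convert this using 3
    · ring
    · ext x; simp

/-! ### Price grids -/

/-- A sequence of prices that is rich enough for the distribution `D`: selling to all agents of an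
upper set, and buying from all agents of a lower set, is approximated by posting the prices of the
sequence in that set. -/
structure IsPriceGrid (q : ℕ → ℝ≥0) (D : Measure ℝ≥0) : Prop where
  upper : ∀ U : Set ℝ≥0, IsUpperSet U → D U ≤ ⨆ k, ⨆ _ : q k ∈ U, D (Ici (q k))
  lower : ∀ U : Set ℝ≥0, IsLowerSet U → D U ≤ ⨆ k, ⨆ _ : q k ∈ U, D (Iic (q k))

/-- A sequence that is dense and runs through all atoms of `D` is a price grid: the union of the
half-lines starting at grid points of `U` misses at most one point of `U`, and that is no atom. -/
theorem isPriceGrid_of_dense {q : ℕ → ℝ≥0} (D : Measure ℝ≥0) (hq : DenseRange q)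
    (hatom : ∀ x, D {x} ≠ 0 → x ∈ range q) : IsPriceGrid q D := by
  have hbetween : ∀ x y : ℝ≥0, x < y → ∃ k, x < q k ∧ q k < y := fun x y h => by
    obtain ⟨_, hz, k, rfl⟩ := hq.inter_open_nonempty _ isOpen_Ioo (nonempty_Ioo.2 h)
    exact ⟨k, hz⟩
  have hnull : ∀ U V : Set ℝ≥0, (U \ V).Subsingleton → (∀ k, q k ∈ U → q k ∈ V) →
      D (U \ V) = 0 := fun U V hs hqV => by
    rcases hs.eq_empty_or_singleton with h | ⟨x, h⟩
    · rw [h, measure_empty]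
    · rw [h]
      by_contra hx
      obtain ⟨k, rfl⟩ := hatom x hx
      have hk : q k ∈ U \ V := by rw [h]; rfl
      exact hk.2 (hqV k hk.1)
  have hle : ∀ U V : Set ℝ≥0, (U \ V).Subsingleton → (∀ k, q k ∈ U → q k ∈ V) →
      D U ≤ D V := fun U V hs hqV => by
    calc D U ≤ D (V ∪ U \ V) := measure_mono fun x hx => by
          by_cases h : x ∈ V
          · exact Or.inl h
          · exact Or.inr ⟨hx, h⟩
      _ ≤ D V + D (U \ V) := measure_union_le _ _
      _ = D V := by rw [hnull U V hs hqV, add_zero]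
  constructor
  · intro U hU
    refine (hle U (⋃ k : {k // q k ∈ U}, Ici (q k)) ?_
      fun k hk => mem_iUnion.2 ⟨⟨k, hk⟩, self_mem_Ici⟩).trans ?_
    · have aux : ∀ x y : ℝ≥0, x ∈ U → y ∉ ⋃ k : {k // q k ∈ U}, Ici (q k) → ¬ x < y := by
        intro x y hx hy hxy
        obtain ⟨k, hk1, hk2⟩ := hbetween x y hxy
        exact hy (mem_iUnion.2 ⟨⟨k, hU hk1.le hx⟩, hk2.le⟩)
      intro x hx y hy
      exact le_antisymm (not_lt.1 (aux y x hy.1 hx.2)) (not_lt.1 (aux x y hx.1 hy.2))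
    · have hdir : Directed (· ⊆ ·) fun k : {k // q k ∈ U} => Ici (q k) := fun a b => by
        rcases le_total (q a) (q b) with h | h
        · exact ⟨a, subset_rfl, Ici_subset_Ici.2 h⟩
        · exact ⟨b, Ici_subset_Ici.2 h, subset_rfl⟩
      rw [hdir.measure_iUnion, iSup_subtype]
  · intro U hU
    refine (hle U (⋃ k : {k // q k ∈ U}, Iic (q k)) ?_
      fun k hk => mem_iUnion.2 ⟨⟨k, hk⟩, self_mem_Iic⟩).trans ?_
    · have aux : ∀ x y : ℝ≥0, x ∈ U → y ∉ ⋃ k : {k // q k ∈ U}, Iic (q k) → ¬ y < x := by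
        intro x y hx hy hxy
        obtain ⟨k, hk1, hk2⟩ := hbetween y x hxy
        exact hy (mem_iUnion.2 ⟨⟨k, hU hk2.le hx⟩, hk1.le⟩)
      intro x hx y hy
      exact le_antisymm (not_lt.1 (aux x y hx.1 hy.2)) (not_lt.1 (aux y x hy.1 hx.2))
    · have hdir : Directed (· ⊆ ·) fun k : {k // q k ∈ U} => Iic (q k) := fun a b => by
        rcases le_total (q a) (q b) with h | h
        · exact ⟨b, Iic_subset_Iic.2 h, subset_rfl⟩
        · exact ⟨a, subset_rfl, Iic_subset_Iic.2 h⟩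
      rw [hdir.measure_iUnion, iSup_subtype]

/-- Countably many distributions have a common price grid. -/
theorem exists_isPriceGrid {ι : Type*} [Countable ι] (D : ι → Measure ℝ≥0)
    [∀ i, IsFiniteMeasure (D i)] : ∃ q : ℕ → ℝ≥0, ∀ i, IsPriceGrid q (D i) := by
  obtain ⟨s, hsc, hsd⟩ := TopologicalSpace.exists_countable_dense ℝ≥0
  have hat : ∀ i, {x | D i {x} ≠ 0}.Countable := fun i => by
    have := Measure.countable_meas_pos_of_disjoint_iUnion (μ := D i) (As := fun x : ℝ≥0 => {x})
      (fun x => measurableSet_singleton x) (fun x y hxy => by simpa using hxy)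
    simpa [pos_iff_ne_zero] using this
  obtain ⟨q, hq⟩ := (hsc.union (countable_iUnion hat)).exists_eq_range
    (hsd.nonempty.mono subset_union_left)
  refine ⟨q, fun i => isPriceGrid_of_dense _ ?_ fun x hx => ?_⟩
  · rw [DenseRange, ← hq]
    exact hsd.mono subset_union_left
  · rw [← hq]
    exact Or.inr (mem_iUnion.2 ⟨i, hx⟩)

/-! ### The two-agent inequality with grid prices -/

/-- The best expected profit of a seller with cost `c` who posts a price of the grid `q`, at which
she is allowed to trade by `R`, to a buyer with value distribution `D`. -/
noncomputable def sellerOffer (D : Measure ℝ≥0) (q : ℕ → ℝ≥0) (R : Set (ℝ≥0 × ℝ≥0)) (c : ℝ≥0) :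
    ℝ≥0∞ :=
  ⨆ k, {c : ℝ≥0 | (q k, c) ∈ R}.indicator
    (fun c => ENNReal.ofReal ((q k : ℝ) - c) * D (Ici (q k))) c

/-- The best expected profit of a buyer with value `v` who posts a price of the grid `q`, at which
she is allowed to trade by `R`, to a seller with cost distribution `F`. -/
noncomputable def buyerOffer (F : Measure ℝ≥0) (q : ℕ → ℝ≥0) (R : Set (ℝ≥0 × ℝ≥0)) (v : ℝ≥0) :
    ℝ≥0∞ :=
  ⨆ k, {v : ℝ≥0 | (v, q k) ∈ R}.indicator
    (fun v => ENNReal.ofReal ((v : ℝ) - q k) * F (Iic (q k))) v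

section TwoAgents

variable {D F : Measure ℝ≥0} {q : ℕ → ℝ≥0} {R : Set (ℝ≥0 × ℝ≥0)} {l : ℝ}

theorem measurable_sellerOffer (hR : MeasurableSet R) : Measurable (sellerOffer D q R) := by
  refine Measurable.iSup fun k => ((Measurable.ennreal_ofReal ?_).mul_const _).indicator
    (measurable_prodMk_left hR)
  exact measurable_const.sub measurable_coe_nnreal_real

theorem measurable_buyerOffer (hR : MeasurableSet R) : Measurable (buyerOffer F q R) := by
  refine Measurable.iSup fun k => ((Measurable.ennreal_ofReal ?_).mul_const _).indicator
    (measurable_prodMk_right hR)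
  exact measurable_coe_nnreal_real.sub measurable_const

/-- Selling at the price `c'` to all values in the upper set `U` is no better than the best grid
price. -/
theorem mul_measure_le_sellerOffer (hq : IsPriceGrid q D) {U : Set ℝ≥0} (hU : IsUpperSet U)
    {c c' : ℝ≥0} (hUR : ∀ v ∈ U, (v, c) ∈ R) (hc' : ∀ v ∈ U, c' ≤ v) :
    ENNReal.ofReal ((c' : ℝ) - c) * D U ≤ sellerOffer D q R c := by
  refine (mul_le_mul_right (hq.upper U hU) _).trans ?_
  rw [ENNReal.mul_iSup]
  refine iSup_le fun k => ?_
  by_cases hk : q k ∈ U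
  · simp only [hk, iSup_pos]
    refine le_trans ?_ (le_iSup _ k)
    rw [indicator_of_mem (s := {c : ℝ≥0 | (q k, c) ∈ R}) (hUR _ hk)]
    gcongr
    exact hc' _ hk
  · simp [hk]

theorem mul_measure_le_buyerOffer (hq : IsPriceGrid q F) {U : Set ℝ≥0} (hU : IsLowerSet U)
    {v v' : ℝ≥0} (hUR : ∀ c ∈ U, (v, c) ∈ R) (hv' : ∀ c ∈ U, c ≤ v') :
    ENNReal.ofReal ((v : ℝ) - v') * F U ≤ buyerOffer F q R v := by
  refine (mul_le_mul_right (hq.lower U hU) _).trans ?_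
  rw [ENNReal.mul_iSup]
  refine iSup_le fun k => ?_
  by_cases hk : q k ∈ U
  · simp only [hk, iSup_pos]
    refine le_trans ?_ (le_iSup _ k)
    rw [indicator_of_mem (s := {v : ℝ≥0 | (v, q k) ∈ R}) (hUR _ hk)]
    gcongr
    exact hv' _ hk
  · simp [hk]

/-- The two-agent inequality for nonnegative values and costs, in both of its forms. -/
theorem lintegral_gain_le_offers [IsProbabilityMeasure D] [IsProbabilityMeasure F]
    (hqD : IsPriceGrid q D) (hqF : IsPriceGrid q F) (hR : MeasurableSet R)
    (hclosed : ∀ {v v' c c' : ℝ≥0}, (v, c) ∈ R → v ≤ v' → c' ≤ c → (v', c') ∈ R)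
    (hcost : ∀ {v c : ℝ≥0}, (v, c) ∈ R → c ≤ v) (hl : l ∈ Ioo (0 : ℝ) 1) :
    (ENNReal.ofReal (1 - l) *
        ∫⁻ p, R.indicator (fun p => ENNReal.ofReal ((p.1 : ℝ) - p.2)) p ∂(D.prod F) ≤
      ∫⁻ c, sellerOffer D q R c ∂F +
        ENNReal.ofReal (Real.log (1 / l)) * ∫⁻ v, buyerOffer F q R v ∂D) ∧
    (ENNReal.ofReal (1 - l) *
        ∫⁻ p, R.indicator (fun p => ENNReal.ofReal ((p.1 : ℝ) - p.2)) p ∂(D.prod F) ≤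
      ∫⁻ v, buyerOffer F q R v ∂D +
        ENNReal.ofReal (Real.log (1 / l)) * ∫⁻ c, sellerOffer D q R c ∂F) := by
  classical
  have hcoe : Measurable ((↑) : ℝ≥0 → ℝ) := measurable_coe_nnreal_real
  have : IsProbabilityMeasure (D.map ((↑) : ℝ≥0 → ℝ)) :=
    Measure.isProbabilityMeasure_map hcoe.aemeasurable
  have : IsProbabilityMeasure (F.map ((↑) : ℝ≥0 → ℝ)) :=
    Measure.isProbabilityMeasure_map hcoe.aemeasurable
  -- negative reals carry no mass; the region and the offers are extended to them arbitrarily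
  set R' : Set (ℝ × ℝ) := {p | (p.1.toNNReal, p.2.toNNReal) ∈ R ∧ p.2 ≤ p.1} with hR'def
  have hR' : IsTradeRegion R' :=
    { measurableSet := ((measurable_fst.real_toNNReal.prodMk measurable_snd.real_toNNReal) hR).inter
        (measurableSet_le measurable_snd measurable_fst)
      closed := fun h h1 h2 => ⟨hclosed h.1 (Real.toNNReal_le_toNNReal h1)
        (Real.toNNReal_le_toNNReal h2), (h2.trans h.2).trans h1⟩
      cost_le := fun h => h.2 }
  have hmem : ∀ v c : ℝ≥0, ((v : ℝ), (c : ℝ)) ∈ R' ↔ (v, c) ∈ R := fun v c => by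
    simp only [hR'def, mem_ofPred_eq, Real.toNNReal_coe, NNReal.coe_le_coe]
    exact ⟨fun h => h.1, fun h => ⟨h, hcost h⟩⟩
  set S : ℝ → ℝ≥0∞ := fun c => if 0 ≤ c then sellerOffer D q R c.toNNReal else ⊤ with hSdef
  set B : ℝ → ℝ≥0∞ := fun v => if 0 ≤ v then buyerOffer F q R v.toNNReal else ⊤ with hBdef
  have hSm : Measurable S := Measurable.ite measurableSet_Ici
    ((measurable_sellerOffer hR).comp measurable_real_toNNReal) measurable_const
  have hBm : Measurable B := Measurable.ite measurableSet_Ici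
    ((measurable_buyerOffer hR).comp measurable_real_toNNReal) measurable_const
  have hScoe : ∀ c : ℝ≥0, S c = sellerOffer D q R c := fun c => by simp [hSdef]
  have hBcoe : ∀ v : ℝ≥0, B v = buyerOffer F q R v := fun v => by simp [hBdef]
  have hSint : ∫⁻ c, S c ∂(F.map ((↑) : ℝ≥0 → ℝ)) = ∫⁻ c, sellerOffer D q R c ∂F := by
    rw [lintegral_map hSm hcoe]
    exact lintegral_congr hScoe
  have hBint : ∫⁻ v, B v ∂(D.map ((↑) : ℝ≥0 → ℝ)) = ∫⁻ v, buyerOffer F q R v ∂D := by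
    rw [lintegral_map hBm hcoe]
    exact lintegral_congr hBcoe
  have hgain : ∫⁻ p, R'.indicator (fun p => ENNReal.ofReal (p.1 - p.2)) p
      ∂((D.map ((↑) : ℝ≥0 → ℝ)).prod (F.map ((↑) : ℝ≥0 → ℝ))) =
      ∫⁻ p, R.indicator (fun p => ENNReal.ofReal ((p.1 : ℝ) - p.2)) p ∂(D.prod F) := by
    rw [Measure.map_prod_map _ _ hcoe hcoe, lintegral_map _ (by fun_prop)]
    · refine lintegral_congr fun p => ?_
      by_cases hp : p ∈ R
      · rw [indicator_of_mem hp]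
        exact indicator_of_mem (s := R') ((hmem p.1 p.2).2 hp) _
      · rw [indicator_of_notMem hp]
        exact indicator_of_notMem (s := R') (fun h => hp ((hmem p.1 p.2).1 h)) _
    · exact (measurable_fst.sub measurable_snd).ennreal_ofReal.indicator hR'.measurableSet
  have hD : ∀ s : Set ℝ, MeasurableSet s →
      D.map ((↑) : ℝ≥0 → ℝ) s = D {v | (v : ℝ) ∈ s} := fun s hs => Measure.map_apply hcoe hs
  have hF : ∀ s : Set ℝ, MeasurableSet s →
      F.map ((↑) : ℝ≥0 → ℝ) s = F {v | (v : ℝ) ∈ s} := fun s hs => Measure.map_apply hcoe hs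
  rw [← hgain, ← hSint, ← hBint]
  constructor
  · refine lintegral_gain_le hR' hl hSm hBm (fun c c' hcc => ?_) fun v c hvc => ?_
    · rcases lt_or_ge c 0 with hc | hc
      · simp [hSdef, not_le.2 hc]
      lift c to ℝ≥0 using hc
      lift c' to ℝ≥0 using c.2.trans hcc
      rw [hScoe, hD {v | (v, (c' : ℝ)) ∈ R'} (measurable_prodMk_right hR'.measurableSet)]
      refine mul_measure_le_sellerOffer hqD (fun v v' hv h => ?_) (fun v h => ?_) fun v h => ?_
      · exact (hmem _ _).2 (hclosed ((hmem _ _).1 h) hv le_rfl)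
      · exact hclosed ((hmem _ _).1 h) le_rfl (by exact_mod_cast hcc)
      · exact hcost ((hmem _ _).1 h)
    · rcases lt_or_ge v 0 with hv | hv
      · simp [hBdef, not_le.2 hv]
      lift v to ℝ≥0 using hv
      rw [hBcoe, hF _ measurableSet_Iic]
      rcases lt_or_ge c 0 with hc | hc
      · have : {x : ℝ≥0 | (x : ℝ) ∈ Iic c} = ∅ :=
          eq_empty_of_forall_notMem fun x hx => absurd (x.2.trans hx) (not_le.2 hc)
        rw [this]
        simp
      lift c to ℝ≥0 using hc
      refine mul_measure_le_buyerOffer hqF (fun x y hxy h => ?_) (fun x h => ?_) fun x h => ?_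
      · exact le_trans (NNReal.coe_le_coe.2 hxy) h
      · exact hclosed ((hmem _ _).1 hvc) le_rfl (NNReal.coe_le_coe.1 h)
      · exact NNReal.coe_le_coe.1 h
  · refine lintegral_gain_le_swap hR' hl hSm hBm (fun v v' hvv => ?_) fun v c hvc => ?_
    · rcases lt_or_ge v 0 with hv | hv
      · simp [hBdef, not_le.2 hv]
      lift v to ℝ≥0 using hv
      rw [hBcoe, hF {c | (v', c) ∈ R'} (measurable_prodMk_left hR'.measurableSet)]
      rcases lt_or_ge v' 0 with hv' | hv'
      · have : {x : ℝ≥0 | (x : ℝ) ∈ {c | (v', c) ∈ R'}} = ∅ :=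
          eq_empty_of_forall_notMem fun x hx => absurd (x.2.trans hx.2) (not_le.2 hv')
        rw [this]
        simp
      lift v' to ℝ≥0 using hv'
      refine mul_measure_le_buyerOffer hqF (fun x y hxy h => ?_) (fun x h => ?_) fun x h => ?_
      · exact (hmem _ _).2 (hclosed ((hmem _ _).1 h) le_rfl hxy)
      · exact hclosed ((hmem _ _).1 h) (by exact_mod_cast hvv) le_rfl
      · exact hcost ((hmem _ _).1 h)
    · rcases lt_or_ge c 0 with hc | hc
      · simp [hSdef, not_le.2 hc]
      lift c to ℝ≥0 using hc
      lift v to ℝ≥0 using c.2.trans hvc.2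
      rw [hScoe, hD _ measurableSet_Ici]
      refine mul_measure_le_sellerOffer hqD (fun x y hxy h => ?_) (fun x h => ?_) fun x h => ?_
      · exact le_trans h (NNReal.coe_le_coe.2 hxy)
      · exact hclosed ((hmem _ _).1 hvc) (NNReal.coe_le_coe.1 h) le_rfl
      · exact NNReal.coe_le_coe.1 h

end TwoAgents

/-! ### First maximizers -/

section FirstMax

variable {ι β : Type*} [Encodable ι] [LinearOrder β]

/-- `a` maximizes `f` on `s`, and it is the first maximizer in the enumeration of `ι`. -/
def IsFirstMax (s : Finset ι) (f : ι → β) (a : ι) : Prop :=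
  a ∈ s ∧ ∀ b ∈ s, f b < f a ∨ (f b = f a ∧ Encodable.encode a ≤ Encodable.encode b)

theorem exists_isFirstMax {s : Finset ι} (hs : s.Nonempty) (f : ι → β) :
    ∃ a, IsFirstMax s f a := by
  obtain ⟨a, ha, hmax⟩ := s.exists_max_image
    (fun a => toLex (f a, OrderDual.toDual (Encodable.encode a))) hs
  refine ⟨a, ha, fun b hb => ?_⟩
  simpa [Prod.Lex.toLex_le_toLex] using hmax b hb

theorem IsFirstMax.unique {s : Finset ι} {f : ι → β} {a b : ι} (ha : IsFirstMax s f a)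
    (hb : IsFirstMax s f b) : a = b := by
  rcases ha.2 b hb.1 with h | h <;> rcases hb.2 a ha.1 with h' | h'
  · exact absurd h h'.asymm
  · exact absurd h'.1 h.ne'
  · exact absurd h.1 h'.ne'
  · exact Encodable.encode_injective (le_antisymm h.2 h'.2)

theorem IsFirstMax.le {s : Finset ι} {f : ι → β} {a b : ι} (ha : IsFirstMax s f a) (hb : b ∈ s) :
    f b ≤ f a :=
  (ha.2 b hb).elim le_of_lt fun h => h.1.le

/-- The first maximizer stays the same if no other value increases by more. -/
theorem IsFirstMax.of_sub_le {s : Finset ι} {f g : ι → ℝ} {a : ι} (ha : IsFirstMax s f a)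
    (h : ∀ b ∈ s, g b - f b ≤ g a - f a) : IsFirstMax s g a := by
  refine ⟨ha.1, fun b hb => ?_⟩
  have hb' := h b hb
  rcases ha.2 b hb with h1 | ⟨h1, h2⟩
  · exact Or.inl (by linarith)
  · rcases lt_or_eq_of_le (show g b ≤ g a by linarith) with h3 | h3
    · exact Or.inl h3
    · exact Or.inr ⟨h3, h2⟩

/-- The first maximizer of `f` on `s`. -/
noncomputable def firstMax (s : Finset ι) (hs : s.Nonempty) (f : ι → β) : ι :=
  Classical.choose (exists_isFirstMax hs f)

theorem isFirstMax_firstMax {s : Finset ι} (hs : s.Nonempty) (f : ι → β) :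
    IsFirstMax s f (firstMax s hs f) :=
  Classical.choose_spec (exists_isFirstMax hs f)

theorem measurableSet_firstMax_eq {Ω : Type*} [MeasurableSpace Ω] [TopologicalSpace β]
    [OrderClosedTopology β] [SecondCountableTopology β] [MeasurableSpace β]
    [OpensMeasurableSpace β] {s : Finset ι} (hs : s.Nonempty) {f : Ω → ι → β}
    (hf : ∀ b, Measurable fun ω => f ω b) (a : ι) :
    MeasurableSet {ω | firstMax s hs (f ω) = a} := by
  have : {ω | firstMax s hs (f ω) = a} =
      {_ω | a ∈ s} ∩ ⋂ b ∈ s, ({ω | f ω b < f ω a} ∪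
        ({ω | f ω b ≤ f ω a} ∩ {ω | f ω a ≤ f ω b} ∩
          {_ω | Encodable.encode a ≤ Encodable.encode b})) := by
    ext ω
    have : firstMax s hs (f ω) = a ↔ IsFirstMax s (f ω) a :=
      ⟨fun h => h ▸ isFirstMax_firstMax hs (f ω), fun h => (isFirstMax_firstMax hs _).unique h⟩
    rw [mem_ofPred_eq, this]
    simp [IsFirstMax, le_antisymm_iff]
  rw [this]
  refine (MeasurableSet.const _).inter (Finset.measurableSet_biInter _ fun b _ => ?_)
  exact (measurableSet_lt (hf b) (hf a)).union
    (((measurableSet_le (hf b) (hf a)).inter (measurableSet_le (hf a) (hf b))).inter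
      (MeasurableSet.const _))

end FirstMax

namespace MatchingMarket

variable {m n : ℕ} (K : MatchingMarket m n)

/-! ### The best matching -/

/-- The feasible matching with the largest gains from trade, with ties broken by a fixed order of
the matchings. -/
noncomputable def bestMatching (v : Fin m → ℝ≥0) (c : Fin n → ℝ≥0) : Finset (Fin m × Fin n) :=
  firstMax K.feasible ⟨∅, K.empty_mem⟩ fun A => gft A v c

variable {K} {v : Fin m → ℝ≥0} {c : Fin n → ℝ≥0}

theorem isFirstMax_bestMatching :
    IsFirstMax K.feasible (fun A => gft A v c) (K.bestMatching v c) :=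
  isFirstMax_firstMax _ _

theorem bestMatching_mem_feasible : K.bestMatching v c ∈ K.feasible :=
  isFirstMax_bestMatching.1

/-- Otherwise removing the pair would improve the matching. -/
theorem cost_le_value_of_mem_bestMatching {e : Fin m × Fin n} (he : e ∈ K.bestMatching v c) :
    c e.2 ≤ v e.1 := by
  by_contra! h
  have h1 := (isFirstMax_bestMatching (K := K) (v := v) (c := c)).le
    (K.downward_closed _ bestMatching_mem_feasible _
      (Finset.erase_subset e (K.bestMatching v c)))
  have h2 : gft (K.bestMatching v c) v c =
      ((v e.1 : ℝ) - c e.2) + gft ((K.bestMatching v c).erase e) v c :=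
    (Finset.add_sum_erase _ _ he).symm
  have h3 : (v e.1 : ℝ) < c e.2 := by exact_mod_cast h
  linarith

/-- Raising the value of a buyer who is matched in the best matching increases the gains of no
feasible matching by more than those of the best one. -/
theorem bestMatching_update_value {i : Fin m} {j : Fin n} {t : ℝ≥0}
    (h : (i, j) ∈ K.bestMatching v c) (ht : v i ≤ t) :
    K.bestMatching (Function.update v i t) c = K.bestMatching v c := by
  refine isFirstMax_bestMatching.unique (isFirstMax_bestMatching.of_sub_le fun A hA => ?_)
  have hdiff : ∀ A : Finset (Fin m × Fin n), gft A (Function.update v i t) c - gft A v c =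
      (A.filter fun e => e.1 = i).card * ((t : ℝ) - v i) := fun A => by
    rw [gft, gft, ← Finset.sum_sub_distrib, ← nsmul_eq_mul, ← Finset.sum_const,
      Finset.sum_filter]
    refine Finset.sum_congr rfl fun e _ => ?_
    by_cases he : e.1 = i
    · simp [he]
    · simp [he]
  rw [hdiff, hdiff]
  have hle : (A.filter fun e => e.1 = i).card ≤ 1 := Finset.card_le_one.2 fun e he e' he' => by
    rw [Finset.mem_filter] at he he'
    exact K.is_matching A hA e he.1 e' he'.1 (Or.inl (he.2.trans he'.2.symm))
  have hge : 0 < ((K.bestMatching v c).filter fun e => e.1 = i).card :=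
    Finset.card_pos.2 ⟨(i, j), Finset.mem_filter.2 ⟨h, rfl⟩⟩
  have hcard : (((A.filter fun e => e.1 = i).card : ℕ) : ℝ) ≤
      (((K.bestMatching v c).filter fun e => e.1 = i).card : ℕ) := by
    exact_mod_cast hle.trans hge
  exact mul_le_mul_of_nonneg_right hcard (sub_nonneg.2 (by exact_mod_cast ht))

theorem bestMatching_update_cost {i : Fin m} {j : Fin n} {t : ℝ≥0}
    (h : (i, j) ∈ K.bestMatching v c) (ht : t ≤ c j) :
    K.bestMatching v (Function.update c j t) = K.bestMatching v c := by
  refine isFirstMax_bestMatching.unique (isFirstMax_bestMatching.of_sub_le fun A hA => ?_)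
  have hdiff : ∀ A : Finset (Fin m × Fin n), gft A v (Function.update c j t) - gft A v c =
      (A.filter fun e => e.2 = j).card * ((c j : ℝ) - t) := fun A => by
    rw [gft, gft, ← Finset.sum_sub_distrib, ← nsmul_eq_mul, ← Finset.sum_const,
      Finset.sum_filter]
    refine Finset.sum_congr rfl fun e _ => ?_
    by_cases he : e.2 = j
    · simp [he]
    · simp [he]
  rw [hdiff, hdiff]
  have hle : (A.filter fun e => e.2 = j).card ≤ 1 := Finset.card_le_one.2 fun e he e' he' => by
    rw [Finset.mem_filter] at he he'
    exact K.is_matching A hA e he.1 e' he'.1 (Or.inr (he.2.trans he'.2.symm))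
  have hge : 0 < ((K.bestMatching v c).filter fun e => e.2 = j).card :=
    Finset.card_pos.2 ⟨(i, j), Finset.mem_filter.2 ⟨h, rfl⟩⟩
  have hcard : (((A.filter fun e => e.2 = j).card : ℕ) : ℝ) ≤
      (((K.bestMatching v c).filter fun e => e.2 = j).card : ℕ) := by
    exact_mod_cast hle.trans hge
  exact mul_le_mul_of_nonneg_right hcard (sub_nonneg.2 (by exact_mod_cast ht))

variable (K) in
theorem measurableSet_mem_bestMatching (e : Fin m × Fin n) :
    MeasurableSet {r : (Fin m → ℝ≥0) × (Fin n → ℝ≥0) | e ∈ K.bestMatching r.1 r.2} := by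
  have : {r : (Fin m → ℝ≥0) × (Fin n → ℝ≥0) | e ∈ K.bestMatching r.1 r.2} =
      ⋃ A : Finset (Fin m × Fin n), {r | K.bestMatching r.1 r.2 = A} ∩ {_r | e ∈ A} := by
    ext r
    simp
  rw [this]
  refine MeasurableSet.iUnion fun A => MeasurableSet.inter ?_ (MeasurableSet.const _)
  refine measurableSet_firstMax_eq (f := fun r : (Fin m → ℝ≥0) × (Fin n → ℝ≥0) =>
    fun A => gft A r.1 r.2) ⟨∅, K.empty_mem⟩ (fun B => ?_) A
  unfold gft
  fun_prop

theorem sup'_gft_eq (v : Fin m → ℝ≥0) (c : Fin n → ℝ≥0) :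
    (K.feasible.sup' ⟨∅, K.empty_mem⟩ fun A => gft A v c) = gft (K.bestMatching v c) v c :=
  le_antisymm (Finset.sup'_le _ _ fun _ hA => isFirstMax_bestMatching.le hA)
    (Finset.le_sup' (fun A => gft A v c) bestMatching_mem_feasible)

end MatchingMarket

/-! ### Expectations and resampling -/

theorem extExpectation_mono {Ω : Type*} [MeasurableSpace Ω] {μ : Measure Ω} {f g : Ω → ℝ}
    (h : ∀ ω, f ω ≤ g ω) : extExpectation μ f ≤ extExpectation μ g := by
  refine EReal.sub_le_sub ?_ ?_
  · exact EReal.coe_ennreal_le_coe_ennreal_iff.2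
      (lintegral_mono fun ω => ENNReal.ofReal_le_ofReal (h ω))
  · exact EReal.coe_ennreal_le_coe_ennreal_iff.2
      (lintegral_mono fun ω => ENNReal.ofReal_le_ofReal (neg_le_neg (h ω)))

theorem extExpectation_of_nonneg {Ω : Type*} [MeasurableSpace Ω] {μ : Measure Ω} {f : Ω → ℝ}
    (h : ∀ ω, 0 ≤ f ω) : extExpectation μ f = ((∫⁻ ω, ENNReal.ofReal (f ω) ∂μ : ℝ≥0∞) : EReal) := by
  have : ∀ ω, ENNReal.ofReal (-f ω) = 0 := fun ω =>
    ENNReal.ofReal_of_nonpos (neg_nonpos.2 (h ω))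
  simp [extExpectation, this]

/-- Resampling one coordinate does not change an integral over a product of probability spaces. -/
theorem lintegral_pi_update {ι : Type*} [Fintype ι] [DecidableEq ι] {X : ι → Type*}
    [∀ i, MeasurableSpace (X i)] (μ : ∀ i, Measure (X i)) [∀ i, IsProbabilityMeasure (μ i)]
    {f : (∀ i, X i) → ℝ≥0∞} (hf : Measurable f) (i : ι) :
    ∫⁻ x, f x ∂Measure.pi μ =
      ∫⁻ x, ∫⁻ t, f (Function.update x i t) ∂μ i ∂Measure.pi μ := by
  refine lintegral_eq_of_lmarginal_eq {i} hf ?_ ?_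
  · exact (hf.comp measurable_update').lintegral_prod_right'
  · rw [lmarginal_singleton, lmarginal_singleton]
    simp

namespace MatchingMarket

variable {m n : ℕ} (K : MatchingMarket m n)

theorem lintegral_law_update_value {f : (Fin m → ℝ≥0) × (Fin n → ℝ≥0) → ℝ≥0∞}
    (hf : Measurable f) (i : Fin m) :
    ∫⁻ r, f r ∂K.law = ∫⁻ r, ∫⁻ t, f (Function.update r.1 i t, r.2) ∂(K.D i) ∂K.law := by
  have hm : Measurable fun p : ((Fin m → ℝ≥0) × (Fin n → ℝ≥0)) × ℝ≥0 =>
      f (Function.update p.1.1 i p.2, p.1.2) :=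
    hf.comp ((measurable_update'.comp (measurable_fst.fst.prodMk measurable_snd)).prodMk
      measurable_fst.snd)
  rw [law, lintegral_prod_symm _ hf.aemeasurable,
    lintegral_prod_symm _ hm.lintegral_prod_right'.aemeasurable]
  refine lintegral_congr fun c => ?_
  exact lintegral_pi_update (fun i => (K.D i : Measure ℝ≥0))
    (f := fun v => f (v, c)) (hf.comp measurable_prodMk_right) i

theorem lintegral_law_update_cost {f : (Fin m → ℝ≥0) × (Fin n → ℝ≥0) → ℝ≥0∞}
    (hf : Measurable f) (j : Fin n) :
    ∫⁻ r, f r ∂K.law = ∫⁻ r, ∫⁻ s, f (r.1, Function.update r.2 j s) ∂(K.F j) ∂K.law := by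
  have hm : Measurable fun p : ((Fin m → ℝ≥0) × (Fin n → ℝ≥0)) × ℝ≥0 =>
      f (p.1.1, Function.update p.1.2 j p.2) :=
    hf.comp (measurable_fst.fst.prodMk
      (measurable_update'.comp (measurable_fst.snd.prodMk measurable_snd)))
  rw [law, lintegral_prod _ hf.aemeasurable,
    lintegral_prod _ hm.lintegral_prod_right'.aemeasurable]
  refine lintegral_congr fun v => ?_
  exact lintegral_pi_update (fun j => (K.F j : Measure ℝ≥0))
    (f := fun c => f (v, c)) (hf.comp measurable_prodMk_left) j

variable {K}

/-! ### Posting prices to the buyers -/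

/-- The trades when every buyer `i` is offered the price `P i`: she buys the item she would get in
the best matching if her value were `P i`, provided that her value is at least `P i`. -/
noncomputable def sellTrades (K : MatchingMarket m n)
    (P : Fin m → (Fin m → ℝ≥0) → (Fin n → ℝ≥0) → ℝ≥0)
    (v : Fin m → ℝ≥0) (c : Fin n → ℝ≥0) : Finset (Fin m × Fin n) :=
  Finset.univ.filter fun e =>
    P e.1 v c ≤ v e.1 ∧ e ∈ K.bestMatching (Function.update v e.1 (P e.1 v c)) c

/-- All trades belong to the best matching at the reported values: raising the value of a buyer from
her price to her report does not change the matching. -/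
theorem sellTrades_mem_feasible (P : Fin m → (Fin m → ℝ≥0) → (Fin n → ℝ≥0) → ℝ≥0)
    (v : Fin m → ℝ≥0) (c : Fin n → ℝ≥0) : K.sellTrades P v c ∈ K.feasible := by
  refine K.downward_closed _ (bestMatching_mem_feasible (v := v) (c := c)) _ fun e he => ?_
  obtain ⟨h1, h2⟩ := (Finset.mem_filter.1 he).2
  have := bestMatching_update_value (i := e.1) (j := e.2) (t := v e.1) h2 (by simpa using h1)
  rw [Function.update_idem, Function.update_eq_self] at this
  rwa [this]

theorem measurableSet_mem_sellTrades {P : Fin m → (Fin m → ℝ≥0) → (Fin n → ℝ≥0) → ℝ≥0}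
    (hP : ∀ i, Measurable fun r : (Fin m → ℝ≥0) × (Fin n → ℝ≥0) => P i r.1 r.2)
    (e : Fin m × Fin n) :
    MeasurableSet {r : (Fin m → ℝ≥0) × (Fin n → ℝ≥0) | e ∈ K.sellTrades P r.1 r.2} := by
  have h1 : MeasurableSet {r : (Fin m → ℝ≥0) × (Fin n → ℝ≥0) | P e.1 r.1 r.2 ≤ r.1 e.1} :=
    measurableSet_le (hP e.1) ((measurable_pi_apply _).comp measurable_fst)
  have h2 : Measurable fun r : (Fin m → ℝ≥0) × (Fin n → ℝ≥0) =>
      (Function.update r.1 e.1 (P e.1 r.1 r.2), r.2) :=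
    (measurable_update'.comp (measurable_fst.prodMk (hP e.1))).prodMk measurable_snd
  convert h1.inter (h2 (K.measurableSet_mem_bestMatching e)) using 1
  ext r
  simp [sellTrades]

/-- The mechanism in which the sellers post the prices `P` to the buyers. -/
noncomputable def sellMechanism (K : MatchingMarket m n)
    (P : Fin m → (Fin m → ℝ≥0) → (Fin n → ℝ≥0) → ℝ≥0)
    (hP : ∀ i, Measurable fun r : (Fin m → ℝ≥0) × (Fin n → ℝ≥0) => P i r.1 r.2) :
    Mechanism K where
  alloc v c := allocOf (K.sellTrades P v c)
  payB v c i := ∑ j, if (i, j) ∈ K.sellTrades P v c then P i v c else 0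
  payS _ _ _ := 0
  alloc_mem v c := subset_convexHull _ _ ⟨_, sellTrades_mem_feasible P v c, rfl⟩
  measurable_alloc := measurable_pi_iff.2 fun _ => measurable_pi_iff.2 fun _ =>
    Measurable.ite (measurableSet_mem_sellTrades hP _) measurable_const measurable_const
  measurable_payB := measurable_pi_iff.2 fun i => Finset.measurable_sum _ fun _ _ =>
    Measurable.ite (measurableSet_mem_sellTrades hP _) (hP i) measurable_const
  measurable_payS := measurable_const

section

variable {P : Fin m → (Fin m → ℝ≥0) → (Fin n → ℝ≥0) → ℝ≥0}
  {hP : ∀ i, Measurable fun r : (Fin m → ℝ≥0) × (Fin n → ℝ≥0) => P i r.1 r.2}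

theorem utilityB_sellMechanism (i : Fin m) (t : ℝ≥0) (v : Fin m → ℝ≥0) (c : Fin n → ℝ≥0) :
    (K.sellMechanism P hP).utilityB i t v c =
      ∑ j, if (i, j) ∈ K.sellTrades P v c then (t : ℝ) - P i v c else 0 := by
  simp only [Mechanism.utilityB, sellMechanism, allocOf, NNReal.coe_sum, Finset.mul_sum,
    ← Finset.sum_sub_distrib]
  refine Finset.sum_congr rfl fun j _ => ?_
  split_ifs <;> simp

theorem irB_sellMechanism : (K.sellMechanism P hP).IRB := by
  intro i v c
  rw [utilityB_sellMechanism]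
  refine Finset.sum_nonneg fun j _ => ?_
  split_ifs with h
  · exact sub_nonneg.2 (NNReal.coe_le_coe.2 (Finset.mem_filter.1 h).2.1)
  · exact le_rfl

/-- Posted prices that do not depend on the buyer's own report are incentive compatible: a truthful
buyer takes exactly the offers that are good for her. -/
theorem bicB_sellMechanism (hPi : ∀ i v c t, P i (Function.update v i t) c = P i v c) :
    (K.sellMechanism P hP).BICB := by
  intro i t t'
  refine extExpectation_mono fun r => ?_
  rw [utilityB_sellMechanism, utilityB_sellMechanism]
  refine Finset.sum_le_sum fun j _ => ?_
  simp only [sellTrades, Finset.mem_filter, Finset.mem_univ, true_and, hPi,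
    Function.update_self, Function.update_idem]
  by_cases hE : (i, j) ∈ K.bestMatching (Function.update r.1 i (P i r.1 r.2)) r.2
  · simp only [hE, and_true]
    rcases le_or_gt (P i r.1 r.2) t with h | h
    · have : (0 : ℝ) ≤ t - P i r.1 r.2 := sub_nonneg.2 (NNReal.coe_le_coe.2 h)
      rw [if_pos h]
      split_ifs <;> linarith
    · have : (t : ℝ) - P i r.1 r.2 < 0 := sub_neg.2 (NNReal.coe_lt_coe.2 h)
      rw [if_neg (not_le.2 h)]
      split_ifs <;> linarith
  · simp [hE]

/-- The expected profit from buyer `i`, given the reports of the others, if she is offered the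
price `p`. -/
noncomputable def sellScore (K : MatchingMarket m n) (i : Fin m) (v : Fin m → ℝ≥0)
    (c : Fin n → ℝ≥0) (p : ℝ≥0) : ℝ≥0∞ :=
  ∑ j, if (i, j) ∈ K.bestMatching (Function.update v i p) c then
    ENNReal.ofReal ((p : ℝ) - c j) * (K.D i : Measure ℝ≥0) (Ici p) else 0

theorem measurable_sellTerm (i : Fin m) (j : Fin n)
    {p : (Fin m → ℝ≥0) × (Fin n → ℝ≥0) → ℝ≥0} (hp : Measurable p) :
    Measurable fun r : (Fin m → ℝ≥0) × (Fin n → ℝ≥0) =>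
      if (i, j) ∈ K.bestMatching (Function.update r.1 i (p r)) r.2 then
        ENNReal.ofReal ((p r : ℝ) - r.2 j) * (K.D i : Measure ℝ≥0) (Ici (p r)) else 0 := by
  have hanti : Antitone fun x : ℝ≥0 => (K.D i : Measure ℝ≥0) (Ici x) := fun x y h =>
    measure_mono (Ici_subset_Ici.2 h)
  refine Measurable.ite (((measurable_update'.comp (measurable_fst.prodMk hp)).prodMk
    measurable_snd) (K.measurableSet_mem_bestMatching (i, j))) ?_ measurable_const
  exact (hp.coe_nnreal_real.sub ((measurable_pi_apply j).comp
    measurable_snd).coe_nnreal_real).ennreal_ofReal.mul (hanti.measurable.comp hp)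

theorem measurable_sellScore (i : Fin m) {p : (Fin m → ℝ≥0) × (Fin n → ℝ≥0) → ℝ≥0}
    (hp : Measurable p) :
    Measurable fun r : (Fin m → ℝ≥0) × (Fin n → ℝ≥0) => K.sellScore i r.1 r.2 (p r) :=
  Finset.measurable_sum _ fun j _ => measurable_sellTerm i j hp

theorem sellersProfit_sellMechanism (hPi : ∀ i v c t, P i (Function.update v i t) c = P i v c) :
    (K.sellMechanism P hP).sellersProfit =
      ((∑ i, ∫⁻ r, K.sellScore i r.1 r.2 (P i r.1 r.2) ∂K.law : ℝ≥0∞) : EReal) := by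
  have hnn : ∀ (v : Fin m → ℝ≥0) (c : Fin n → ℝ≥0) (i : Fin m) (j : Fin n),
      0 ≤ if (i, j) ∈ K.sellTrades P v c then (P i v c : ℝ) - c j else 0 := fun v c i j => by
    split_ifs with h
    · have := cost_le_value_of_mem_bestMatching (Finset.mem_filter.1 h).2.2
      simp only [Function.update_self] at this
      exact sub_nonneg.2 (NNReal.coe_le_coe.2 this)
    · exact le_rfl
  have heq : ∀ r : (Fin m → ℝ≥0) × (Fin n → ℝ≥0),
      (∑ i, ((K.sellMechanism P hP).payB r.1 r.2 i : ℝ)) -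
        ∑ j, (r.2 j : ℝ) * ∑ i, (K.sellMechanism P hP).alloc r.1 r.2 i j =
      ∑ i, ∑ j, if (i, j) ∈ K.sellTrades P r.1 r.2 then (P i r.1 r.2 : ℝ) - r.2 j else 0 := by
    intro r
    simp only [sellMechanism, allocOf, NNReal.coe_sum, Finset.mul_sum]
    rw [Finset.sum_comm (γ := Fin n) (s := Finset.univ) (t := Finset.univ)
      (f := fun j i => (r.2 j : ℝ) * if (i, j) ∈ K.sellTrades P r.1 r.2 then 1 else 0)]
    simp only [← Finset.sum_sub_distrib]
    refine Finset.sum_congr rfl fun i _ => Finset.sum_congr rfl fun j _ => ?_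
    split_ifs <;> simp
  have hterm : ∀ i j, Measurable fun r : (Fin m → ℝ≥0) × (Fin n → ℝ≥0) => ENNReal.ofReal
      (if (i, j) ∈ K.sellTrades P r.1 r.2 then (P i r.1 r.2 : ℝ) - r.2 j else 0) := fun i j =>
    (Measurable.ite (measurableSet_mem_sellTrades hP _) ((hP i).coe_nnreal_real.sub
      ((measurable_pi_apply j).comp measurable_snd).coe_nnreal_real)
      measurable_const).ennreal_ofReal
  rw [Mechanism.sellersProfit]
  simp only [heq]
  rw [extExpectation_of_nonneg fun r => Finset.sum_nonneg fun i _ => Finset.sum_nonneg fun j _ =>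
    hnn r.1 r.2 i j]
  congr 1
  have hsum : ∀ r : (Fin m → ℝ≥0) × (Fin n → ℝ≥0), ENNReal.ofReal (∑ i, ∑ j,
      if (i, j) ∈ K.sellTrades P r.1 r.2 then (P i r.1 r.2 : ℝ) - r.2 j else 0) =
      ∑ i, ∑ j, ENNReal.ofReal
        (if (i, j) ∈ K.sellTrades P r.1 r.2 then (P i r.1 r.2 : ℝ) - r.2 j else 0) := fun r => by
    rw [ENNReal.ofReal_sum_of_nonneg fun i _ => Finset.sum_nonneg fun j _ => hnn r.1 r.2 i j]
    exact Finset.sum_congr rfl fun i _ =>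
      ENNReal.ofReal_sum_of_nonneg fun j _ => hnn r.1 r.2 i j
  simp only [hsum]
  rw [lintegral_finsetSum _ fun i _ => Finset.measurable_sum _ fun j _ => hterm i j]
  refine Finset.sum_congr rfl fun i _ => ?_
  -- the offer to buyer `i` does not depend on her value, so she accepts with the probability that
  -- a fresh value is at least the price
  rw [lintegral_law_update_value K (Finset.measurable_sum _ fun j _ => hterm i j) i]
  refine lintegral_congr fun r => ?_
  have hu : Measurable fun t => (Function.update r.1 i t, r.2) :=
    (measurable_update r.1).prodMk measurable_const
  rw [lintegral_finsetSum]
  swap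
  · exact fun j _ => (hterm i j).comp hu
  refine Finset.sum_congr rfl fun j _ => ?_
  simp only [sellTrades, Finset.mem_filter, Finset.mem_univ, true_and, hPi,
    Function.update_self, Function.update_idem]
  by_cases hE : (i, j) ∈ K.bestMatching (Function.update r.1 i (P i r.1 r.2)) r.2
  · simp only [hE, and_true, if_true]
    rw [← lintegral_indicator_const measurableSet_Ici]
    refine lintegral_congr fun t => ?_
    by_cases ht : P i r.1 r.2 ≤ t
    · rw [if_pos ht, indicator_of_mem (mem_Ici.2 ht)]
    · rw [if_neg ht, indicator_of_notMem (fun h => ht (mem_Ici.1 h)), ENNReal.ofReal_zero]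
  · simp [hE]

end

/-- The supremum over all prices of the grid can be approached by posted prices, hence it bounds
the optimal profit of the sellers from below. -/
theorem sum_lintegral_iSup_sellScore_le (K : MatchingMarket m n) (q : ℕ → ℝ≥0) :
    ((∑ i, ∫⁻ r, ⨆ k, K.sellScore i r.1 r.2 (q k) ∂K.law : ℝ≥0∞) : EReal) ≤
      K.optSellersProfit := by
  set h : ℕ → Fin m → (Fin m → ℝ≥0) × (Fin n → ℝ≥0) → ℝ≥0∞ := fun N i r =>
    ⨆ k ∈ Finset.range (N + 1), K.sellScore i r.1 r.2 (q k) with hdef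
  have hhm : ∀ N i, Measurable (h N i) := fun N i =>
    Measurable.iSup fun k => Measurable.iSup fun _ => measurable_sellScore i measurable_const
  have hmono : ∀ i, Monotone fun N => h N i := fun i N N' hN r =>
    biSup_mono fun k hk => Finset.mem_range.2 (by have := Finset.mem_range.1 hk; omega)
  have hsup : ∀ i r, ⨆ k, K.sellScore i r.1 r.2 (q k) = ⨆ N, h N i r := fun i r => by
    refine le_antisymm (iSup_le fun k => ?_) (iSup_le fun N => iSup₂_le fun k _ =>
      le_iSup (fun k => K.sellScore i r.1 r.2 (q k)) k)
    exact le_iSup_of_le k (le_iSup₂_of_le k (Finset.mem_range.2 (Nat.lt_succ_self k)) le_rfl)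
  have hN : ∀ N, ((∑ i, ∫⁻ r, h N i r ∂K.law : ℝ≥0∞) : EReal) ≤ K.optSellersProfit := by
    intro N
    have hne : (Finset.range (N + 1)).Nonempty := Finset.nonempty_range_add_one
    set P : Fin m → (Fin m → ℝ≥0) → (Fin n → ℝ≥0) → ℝ≥0 := fun i v c =>
      q (firstMax (Finset.range (N + 1)) hne fun k => K.sellScore i v c (q k)) with hPdef
    have hP : ∀ i, Measurable fun r : (Fin m → ℝ≥0) × (Fin n → ℝ≥0) => P i r.1 r.2 := fun i =>
      measurable_from_top.comp (measurable_to_countable' fun k =>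
        measurableSet_firstMax_eq hne
          (fun k => measurable_sellScore (K := K) i (measurable_const (a := q k))) k)
    have hPi : ∀ i v c t, P i (Function.update v i t) c = P i v c := fun i v c t => by
      simp only [hPdef, sellScore, Function.update_idem]
    have hscore : ∀ i r, h N i r = K.sellScore i r.1 r.2 (P i r.1 r.2) := fun i r => by
      have hmax := isFirstMax_firstMax hne fun k => K.sellScore i r.1 r.2 (q k)
      exact le_antisymm (iSup₂_le fun k hk => hmax.le hk)
        (le_iSup₂_of_le _ hmax.1 le_rfl)
    refine le_sSup ⟨K.sellMechanism P hP, bicB_sellMechanism hPi, irB_sellMechanism, ?_⟩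
    rw [sellersProfit_sellMechanism hPi]
    simp only [hscore]
  have hnn : 0 ≤ K.optSellersProfit := (EReal.coe_ennreal_nonneg _).trans (hN 0)
  rw [← EReal.coe_toENNReal hnn, EReal.coe_ennreal_le_coe_ennreal_iff]
  have hint : ∀ i, ∫⁻ r, ⨆ k, K.sellScore i r.1 r.2 (q k) ∂K.law =
      ⨆ N, ∫⁻ r, h N i r ∂K.law := fun i => by
    simp only [hsup]
    exact lintegral_iSup (fun N => hhm N i) (hmono i)
  simp only [hint]
  rw [ENNReal.finsetSum_iSup_of_monotone fun i N N' hNN => lintegral_mono (hmono i hNN)]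
  refine iSup_le fun N => ?_
  rw [← EReal.coe_ennreal_le_coe_ennreal_iff, EReal.coe_toENNReal hnn]
  exact hN N

end MatchingMarket

namespace MatchingMarket

variable {m n : ℕ} {K : MatchingMarket m n}

/-! ### Posting prices to the sellers -/

/-- The trades when every seller `j` is offered the price `P j`: she sells to the buyer she would
be matched to in the best matching if her cost were `P j`, provided that her cost is at most
`P j`. -/
noncomputable def buyTrades (K : MatchingMarket m n)
    (P : Fin n → (Fin m → ℝ≥0) → (Fin n → ℝ≥0) → ℝ≥0)
    (v : Fin m → ℝ≥0) (c : Fin n → ℝ≥0) : Finset (Fin m × Fin n) :=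
  Finset.univ.filter fun e =>
    c e.2 ≤ P e.2 v c ∧ e ∈ K.bestMatching v (Function.update c e.2 (P e.2 v c))

theorem buyTrades_mem_feasible (P : Fin n → (Fin m → ℝ≥0) → (Fin n → ℝ≥0) → ℝ≥0)
    (v : Fin m → ℝ≥0) (c : Fin n → ℝ≥0) : K.buyTrades P v c ∈ K.feasible := by
  refine K.downward_closed _ (bestMatching_mem_feasible (v := v) (c := c)) _ fun e he => ?_
  obtain ⟨h1, h2⟩ := (Finset.mem_filter.1 he).2
  have := bestMatching_update_cost (i := e.1) (j := e.2) (t := c e.2) h2 (by simpa using h1)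
  rw [Function.update_idem, Function.update_eq_self] at this
  rwa [this]

theorem measurableSet_mem_buyTrades {P : Fin n → (Fin m → ℝ≥0) → (Fin n → ℝ≥0) → ℝ≥0}
    (hP : ∀ j, Measurable fun r : (Fin m → ℝ≥0) × (Fin n → ℝ≥0) => P j r.1 r.2)
    (e : Fin m × Fin n) :
    MeasurableSet {r : (Fin m → ℝ≥0) × (Fin n → ℝ≥0) | e ∈ K.buyTrades P r.1 r.2} := by
  have h1 : MeasurableSet {r : (Fin m → ℝ≥0) × (Fin n → ℝ≥0) | r.2 e.2 ≤ P e.2 r.1 r.2} :=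
    measurableSet_le ((measurable_pi_apply _).comp measurable_snd) (hP e.2)
  have h2 : Measurable fun r : (Fin m → ℝ≥0) × (Fin n → ℝ≥0) =>
      (r.1, Function.update r.2 e.2 (P e.2 r.1 r.2)) :=
    measurable_fst.prodMk (measurable_update'.comp (measurable_snd.prodMk (hP e.2)))
  convert h1.inter (h2 (K.measurableSet_mem_bestMatching e)) using 1
  ext r
  simp [buyTrades]

/-- The mechanism in which the buyers post the prices `P` to the sellers. -/
noncomputable def buyMechanism (K : MatchingMarket m n)
    (P : Fin n → (Fin m → ℝ≥0) → (Fin n → ℝ≥0) → ℝ≥0)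
    (hP : ∀ j, Measurable fun r : (Fin m → ℝ≥0) × (Fin n → ℝ≥0) => P j r.1 r.2) :
    Mechanism K where
  alloc v c := allocOf (K.buyTrades P v c)
  payB _ _ _ := 0
  payS v c j := ∑ i, if (i, j) ∈ K.buyTrades P v c then P j v c else 0
  alloc_mem v c := subset_convexHull _ _ ⟨_, buyTrades_mem_feasible P v c, rfl⟩
  measurable_alloc := measurable_pi_iff.2 fun _ => measurable_pi_iff.2 fun _ =>
    Measurable.ite (measurableSet_mem_buyTrades hP _) measurable_const measurable_const
  measurable_payB := measurable_const
  measurable_payS := measurable_pi_iff.2 fun j => Finset.measurable_sum _ fun _ _ =>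
    Measurable.ite (measurableSet_mem_buyTrades hP _) (hP j) measurable_const

section

variable {P : Fin n → (Fin m → ℝ≥0) → (Fin n → ℝ≥0) → ℝ≥0}
  {hP : ∀ j, Measurable fun r : (Fin m → ℝ≥0) × (Fin n → ℝ≥0) => P j r.1 r.2}

theorem utilityS_buyMechanism (j : Fin n) (t : ℝ≥0) (v : Fin m → ℝ≥0) (c : Fin n → ℝ≥0) :
    (K.buyMechanism P hP).utilityS j t v c =
      ∑ i, if (i, j) ∈ K.buyTrades P v c then (P j v c : ℝ) - t else 0 := by
  simp only [Mechanism.utilityS, buyMechanism, allocOf, NNReal.coe_sum, Finset.mul_sum,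
    ← Finset.sum_sub_distrib]
  refine Finset.sum_congr rfl fun i _ => ?_
  split_ifs <;> simp

theorem irS_buyMechanism : (K.buyMechanism P hP).IRS := by
  intro j v c
  rw [utilityS_buyMechanism]
  refine Finset.sum_nonneg fun i _ => ?_
  split_ifs with h
  · exact sub_nonneg.2 (NNReal.coe_le_coe.2 (Finset.mem_filter.1 h).2.1)
  · exact le_rfl

theorem bicS_buyMechanism (hPj : ∀ j v c t, P j v (Function.update c j t) = P j v c) :
    (K.buyMechanism P hP).BICS := by
  intro j t t'
  refine extExpectation_mono fun r => ?_
  rw [utilityS_buyMechanism, utilityS_buyMechanism]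
  refine Finset.sum_le_sum fun i _ => ?_
  simp only [buyTrades, Finset.mem_filter, Finset.mem_univ, true_and, hPj,
    Function.update_self, Function.update_idem]
  by_cases hE : (i, j) ∈ K.bestMatching r.1 (Function.update r.2 j (P j r.1 r.2))
  · simp only [hE, and_true]
    rcases le_or_gt t (P j r.1 r.2) with h | h
    · have : (0 : ℝ) ≤ P j r.1 r.2 - t := sub_nonneg.2 (NNReal.coe_le_coe.2 h)
      rw [if_pos h]
      split_ifs <;> linarith
    · have : (P j r.1 r.2 : ℝ) - t < 0 := sub_neg.2 (NNReal.coe_lt_coe.2 h)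
      rw [if_neg (not_le.2 h)]
      split_ifs <;> linarith
  · simp [hE]

/-- The expected profit from seller `j`, given the reports of the others, if she is offered the
price `p`. -/
noncomputable def buyScore (K : MatchingMarket m n) (j : Fin n) (v : Fin m → ℝ≥0)
    (c : Fin n → ℝ≥0) (p : ℝ≥0) : ℝ≥0∞ :=
  ∑ i, if (i, j) ∈ K.bestMatching v (Function.update c j p) then
    ENNReal.ofReal ((v i : ℝ) - p) * (K.F j : Measure ℝ≥0) (Iic p) else 0

theorem measurable_buyTerm (i : Fin m) (j : Fin n)
    {p : (Fin m → ℝ≥0) × (Fin n → ℝ≥0) → ℝ≥0} (hp : Measurable p) :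
    Measurable fun r : (Fin m → ℝ≥0) × (Fin n → ℝ≥0) =>
      if (i, j) ∈ K.bestMatching r.1 (Function.update r.2 j (p r)) then
        ENNReal.ofReal ((r.1 i : ℝ) - p r) * (K.F j : Measure ℝ≥0) (Iic (p r)) else 0 := by
  have hmono : Monotone fun x : ℝ≥0 => (K.F j : Measure ℝ≥0) (Iic x) := fun x y h =>
    measure_mono (Iic_subset_Iic.2 h)
  refine Measurable.ite ((measurable_fst.prodMk (measurable_update'.comp
    (measurable_snd.prodMk hp))) (K.measurableSet_mem_bestMatching (i, j))) ?_ measurable_const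
  exact (((measurable_pi_apply i).comp measurable_fst).coe_nnreal_real.sub
    hp.coe_nnreal_real).ennreal_ofReal.mul (hmono.measurable.comp hp)

theorem measurable_buyScore (j : Fin n) {p : (Fin m → ℝ≥0) × (Fin n → ℝ≥0) → ℝ≥0}
    (hp : Measurable p) :
    Measurable fun r : (Fin m → ℝ≥0) × (Fin n → ℝ≥0) => K.buyScore j r.1 r.2 (p r) :=
  Finset.measurable_sum _ fun i _ => measurable_buyTerm i j hp

theorem buyersProfit_buyMechanism (hPj : ∀ j v c t, P j v (Function.update c j t) = P j v c) :
    (K.buyMechanism P hP).buyersProfit =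
      ((∑ j, ∫⁻ r, K.buyScore j r.1 r.2 (P j r.1 r.2) ∂K.law : ℝ≥0∞) : EReal) := by
  have hnn : ∀ (v : Fin m → ℝ≥0) (c : Fin n → ℝ≥0) (j : Fin n) (i : Fin m),
      0 ≤ if (i, j) ∈ K.buyTrades P v c then (v i : ℝ) - P j v c else 0 := fun v c j i => by
    split_ifs with h
    · have := cost_le_value_of_mem_bestMatching (Finset.mem_filter.1 h).2.2
      simp only [Function.update_self] at this
      exact sub_nonneg.2 (NNReal.coe_le_coe.2 this)
    · exact le_rfl
  have heq : ∀ r : (Fin m → ℝ≥0) × (Fin n → ℝ≥0),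
      (∑ i, (r.1 i : ℝ) * ∑ j, (K.buyMechanism P hP).alloc r.1 r.2 i j) -
        ∑ j, ((K.buyMechanism P hP).payS r.1 r.2 j : ℝ) =
      ∑ j, ∑ i, if (i, j) ∈ K.buyTrades P r.1 r.2 then (r.1 i : ℝ) - P j r.1 r.2 else 0 := by
    intro r
    simp only [buyMechanism, allocOf, NNReal.coe_sum, Finset.mul_sum]
    rw [Finset.sum_comm (γ := Fin m) (s := Finset.univ) (t := Finset.univ)
      (f := fun i j => (r.1 i : ℝ) * if (i, j) ∈ K.buyTrades P r.1 r.2 then 1 else 0)]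
    simp only [← Finset.sum_sub_distrib]
    refine Finset.sum_congr rfl fun j _ => Finset.sum_congr rfl fun i _ => ?_
    split_ifs <;> simp
  have hterm : ∀ j i, Measurable fun r : (Fin m → ℝ≥0) × (Fin n → ℝ≥0) => ENNReal.ofReal
      (if (i, j) ∈ K.buyTrades P r.1 r.2 then (r.1 i : ℝ) - P j r.1 r.2 else 0) := fun j i =>
    (Measurable.ite (measurableSet_mem_buyTrades hP _)
      (((measurable_pi_apply i).comp measurable_fst).coe_nnreal_real.sub (hP j).coe_nnreal_real)
      measurable_const).ennreal_ofReal
  rw [Mechanism.buyersProfit]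
  simp only [heq]
  rw [extExpectation_of_nonneg fun r => Finset.sum_nonneg fun j _ => Finset.sum_nonneg fun i _ =>
    hnn r.1 r.2 j i]
  congr 1
  have hsum : ∀ r : (Fin m → ℝ≥0) × (Fin n → ℝ≥0), ENNReal.ofReal (∑ j, ∑ i,
      if (i, j) ∈ K.buyTrades P r.1 r.2 then (r.1 i : ℝ) - P j r.1 r.2 else 0) =
      ∑ j, ∑ i, ENNReal.ofReal
        (if (i, j) ∈ K.buyTrades P r.1 r.2 then (r.1 i : ℝ) - P j r.1 r.2 else 0) := fun r => by
    rw [ENNReal.ofReal_sum_of_nonneg fun j _ => Finset.sum_nonneg fun i _ => hnn r.1 r.2 j i]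
    exact Finset.sum_congr rfl fun j _ =>
      ENNReal.ofReal_sum_of_nonneg fun i _ => hnn r.1 r.2 j i
  simp only [hsum]
  rw [lintegral_finsetSum _ fun j _ => Finset.measurable_sum _ fun i _ => hterm j i]
  refine Finset.sum_congr rfl fun j _ => ?_
  -- the offer to seller `j` does not depend on her cost, so she accepts with the probability that
  -- a fresh cost is at most the price
  rw [lintegral_law_update_cost K (Finset.measurable_sum _ fun i _ => hterm j i) j]
  refine lintegral_congr fun r => ?_
  have hu : Measurable fun t => (r.1, Function.update r.2 j t) :=
    measurable_const.prodMk (measurable_update r.2)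
  rw [lintegral_finsetSum]
  swap
  · exact fun i _ => (hterm j i).comp hu
  refine Finset.sum_congr rfl fun i _ => ?_
  simp only [buyTrades, Finset.mem_filter, Finset.mem_univ, true_and, hPj,
    Function.update_self, Function.update_idem]
  by_cases hE : (i, j) ∈ K.bestMatching r.1 (Function.update r.2 j (P j r.1 r.2))
  · simp only [hE, and_true, if_true]
    rw [← lintegral_indicator_const measurableSet_Iic]
    refine lintegral_congr fun t => ?_
    by_cases ht : t ≤ P j r.1 r.2
    · rw [if_pos ht, indicator_of_mem (mem_Iic.2 ht)]
    · rw [if_neg ht, indicator_of_notMem (fun h => ht (mem_Iic.1 h)), ENNReal.ofReal_zero]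
  · simp [hE]

end

theorem sum_lintegral_iSup_buyScore_le (K : MatchingMarket m n) (q : ℕ → ℝ≥0) :
    ((∑ j, ∫⁻ r, ⨆ k, K.buyScore j r.1 r.2 (q k) ∂K.law : ℝ≥0∞) : EReal) ≤
      K.optBuyersProfit := by
  set h : ℕ → Fin n → (Fin m → ℝ≥0) × (Fin n → ℝ≥0) → ℝ≥0∞ := fun N j r =>
    ⨆ k ∈ Finset.range (N + 1), K.buyScore j r.1 r.2 (q k) with hdef
  have hhm : ∀ N j, Measurable (h N j) := fun N j =>
    Measurable.iSup fun k => Measurable.iSup fun _ => measurable_buyScore j measurable_const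
  have hmono : ∀ j, Monotone fun N => h N j := fun j N N' hN r =>
    biSup_mono fun k hk => Finset.mem_range.2 (by have := Finset.mem_range.1 hk; omega)
  have hsup : ∀ j r, ⨆ k, K.buyScore j r.1 r.2 (q k) = ⨆ N, h N j r := fun j r => by
    refine le_antisymm (iSup_le fun k => ?_) (iSup_le fun N => iSup₂_le fun k _ =>
      le_iSup (fun k => K.buyScore j r.1 r.2 (q k)) k)
    exact le_iSup_of_le k (le_iSup₂_of_le k (Finset.mem_range.2 (Nat.lt_succ_self k)) le_rfl)
  have hN : ∀ N, ((∑ j, ∫⁻ r, h N j r ∂K.law : ℝ≥0∞) : EReal) ≤ K.optBuyersProfit := by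
    intro N
    have hne : (Finset.range (N + 1)).Nonempty := Finset.nonempty_range_add_one
    set P : Fin n → (Fin m → ℝ≥0) → (Fin n → ℝ≥0) → ℝ≥0 := fun j v c =>
      q (firstMax (Finset.range (N + 1)) hne fun k => K.buyScore j v c (q k)) with hPdef
    have hP : ∀ j, Measurable fun r : (Fin m → ℝ≥0) × (Fin n → ℝ≥0) => P j r.1 r.2 := fun j =>
      measurable_from_top.comp (measurable_to_countable' fun k =>
        measurableSet_firstMax_eq hne
          (fun k => measurable_buyScore (K := K) j (measurable_const (a := q k))) k)
    have hPj : ∀ j v c t, P j v (Function.update c j t) = P j v c := fun j v c t => by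
      simp only [hPdef, buyScore, Function.update_idem]
    have hscore : ∀ j r, h N j r = K.buyScore j r.1 r.2 (P j r.1 r.2) := fun j r => by
      have hmax := isFirstMax_firstMax hne fun k => K.buyScore j r.1 r.2 (q k)
      exact le_antisymm (iSup₂_le fun k hk => hmax.le hk)
        (le_iSup₂_of_le _ hmax.1 le_rfl)
    refine le_sSup ⟨K.buyMechanism P hP, bicS_buyMechanism hPj, irS_buyMechanism, ?_⟩
    rw [buyersProfit_buyMechanism hPj]
    simp only [hscore]
  have hnn : 0 ≤ K.optBuyersProfit := (EReal.coe_ennreal_nonneg _).trans (hN 0)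
  rw [← EReal.coe_toENNReal hnn, EReal.coe_ennreal_le_coe_ennreal_iff]
  have hint : ∀ j, ∫⁻ r, ⨆ k, K.buyScore j r.1 r.2 (q k) ∂K.law =
      ⨆ N, ∫⁻ r, h N j r ∂K.law := fun j => by
    simp only [hsup]
    exact lintegral_iSup (fun N => hhm N j) (hmono j)
  simp only [hint]
  rw [ENNReal.finsetSum_iSup_of_monotone fun j N N' hNN => lintegral_mono (hmono j hNN)]
  refine iSup_le fun N => ?_
  rw [← EReal.coe_ennreal_le_coe_ennreal_iff, EReal.coe_toENNReal hnn]
  exact hN N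

end MatchingMarket

/-- If at most one row of `a` is nonzero, then the supremum of the column sums is at least the sum
of the suprema of the rows. -/
theorem sum_iSup_le_iSup_sum {ι κ : Type*} [Fintype ι] {a : ι → κ → ℝ≥0∞}
    (h : ∀ i i' k k', a i k ≠ 0 → a i' k' ≠ 0 → i = i') :
    ∑ i, ⨆ k, a i k ≤ ⨆ k, ∑ i, a i k := by
  by_cases h0 : ∃ i k, a i k ≠ 0
  · obtain ⟨i, k, hik⟩ := h0
    rw [Finset.sum_eq_single i]
    · exact iSup_mono fun k => Finset.single_le_sum (f := fun i => a i k)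
        (fun _ _ => zero_le) (Finset.mem_univ i)
    · intro i' _ hi'
      simp only [ENNReal.iSup_eq_zero]
      exact fun k' => by_contra fun hk' => hi' (h _ _ _ _ hk' hik)
    · exact fun hi => absurd (Finset.mem_univ i) hi
  · push Not at h0
    simp [h0]

namespace MatchingMarket

variable {m n : ℕ} {K : MatchingMarket m n}

/-! ### From pairs to the market -/

/-- The profit, in expectation over the value of buyer `i`, of the best grid price at which `i` is
matched to seller `j`. -/
noncomputable def sellPairBound (K : MatchingMarket m n) (q : ℕ → ℝ≥0) (i : Fin m) (j : Fin n)
    (r : (Fin m → ℝ≥0) × (Fin n → ℝ≥0)) : ℝ≥0∞ :=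
  ⨆ k, if (i, j) ∈ K.bestMatching (Function.update r.1 i (q k)) r.2 then
    ENNReal.ofReal ((q k : ℝ) - r.2 j) * (K.D i : Measure ℝ≥0) (Ici (q k)) else 0

/-- The profit, in expectation over the cost of seller `j`, of the best grid price at which `j` is
matched to buyer `i`. -/
noncomputable def buyPairBound (K : MatchingMarket m n) (q : ℕ → ℝ≥0) (i : Fin m) (j : Fin n)
    (r : (Fin m → ℝ≥0) × (Fin n → ℝ≥0)) : ℝ≥0∞ :=
  ⨆ k, if (i, j) ∈ K.bestMatching r.1 (Function.update r.2 j (q k)) then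
    ENNReal.ofReal ((r.1 i : ℝ) - q k) * (K.F j : Measure ℝ≥0) (Iic (q k)) else 0

theorem measurable_sellPairBound (q : ℕ → ℝ≥0) (i : Fin m) (j : Fin n) :
    Measurable (K.sellPairBound q i j) :=
  Measurable.iSup fun _ => measurable_sellTerm i j measurable_const

theorem measurable_buyPairBound (q : ℕ → ℝ≥0) (i : Fin m) (j : Fin n) :
    Measurable (K.buyPairBound q i j) :=
  Measurable.iSup fun _ => measurable_buyTerm i j measurable_const

/-- A buyer is matched to the same seller at all of her values at which she is matched. -/
theorem seller_unique {i : Fin m} {j j' : Fin n} {v : Fin m → ℝ≥0} {c : Fin n → ℝ≥0} {s t : ℝ≥0}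
    (h : (i, j) ∈ K.bestMatching (Function.update v i s) c)
    (h' : (i, j') ∈ K.bestMatching (Function.update v i t) c) : j = j' := by
  wlog hst : s ≤ t generalizing s t j j'
  · exact (this h' h (le_of_not_ge hst)).symm
  have := bestMatching_update_value (t := t) h (by simpa using hst)
  rw [Function.update_idem] at this
  rw [this] at h'
  exact (Prod.ext_iff.1 (K.is_matching _ bestMatching_mem_feasible _ h _ h' (Or.inl rfl))).2

/-- A seller is matched to the same buyer at all of her costs at which she is matched. -/
theorem buyer_unique {i i' : Fin m} {j : Fin n} {v : Fin m → ℝ≥0} {c : Fin n → ℝ≥0} {s t : ℝ≥0}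
    (h : (i, j) ∈ K.bestMatching v (Function.update c j s))
    (h' : (i', j) ∈ K.bestMatching v (Function.update c j t)) : i = i' := by
  wlog hst : t ≤ s generalizing s t i i'
  · exact (this h' h (le_of_not_ge hst)).symm
  have := bestMatching_update_cost (t := t) h (by simpa using hst)
  rw [Function.update_idem] at this
  rw [this] at h'
  exact (Prod.ext_iff.1 (K.is_matching _ bestMatching_mem_feasible _ h _ h' (Or.inr rfl))).1

theorem sum_sellPairBound_le (q : ℕ → ℝ≥0) (i : Fin m) (r : (Fin m → ℝ≥0) × (Fin n → ℝ≥0)) :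
    ∑ j, K.sellPairBound q i j r ≤ ⨆ k, K.sellScore i r.1 r.2 (q k) := by
  refine sum_iSup_le_iSup_sum fun j j' k k' h h' => ?_
  exact seller_unique (by_contra fun hn => h (if_neg hn))
    (by_contra fun hn => h' (if_neg hn))

theorem sum_buyPairBound_le (q : ℕ → ℝ≥0) (j : Fin n) (r : (Fin m → ℝ≥0) × (Fin n → ℝ≥0)) :
    ∑ i, K.buyPairBound q i j r ≤ ⨆ k, K.buyScore j r.1 r.2 (q k) := by
  refine sum_iSup_le_iSup_sum fun j j' k k' h h' => ?_
  exact buyer_unique (by_contra fun hn => h (if_neg hn))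
    (by_contra fun hn => h' (if_neg hn))

/-- The gain of the pair `(i, j)` in the best matching. -/
noncomputable def pairGain (K : MatchingMarket m n) (i : Fin m) (j : Fin n)
    (r : (Fin m → ℝ≥0) × (Fin n → ℝ≥0)) : ℝ≥0∞ :=
  if (i, j) ∈ K.bestMatching r.1 r.2 then ENNReal.ofReal ((r.1 i : ℝ) - r.2 j) else 0

theorem measurable_pairGain (i : Fin m) (j : Fin n) : Measurable (K.pairGain i j) :=
  Measurable.ite (K.measurableSet_mem_bestMatching (i, j))
    (((measurable_pi_apply i).comp measurable_fst).coe_nnreal_real.sub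
      ((measurable_pi_apply j).comp measurable_snd).coe_nnreal_real).ennreal_ofReal
    measurable_const

/-- The pairs of a value of `i` and a cost of `j` at which `i` and `j` are matched in the best
matching, when all other values and costs are as in `r`. -/
def matchRegion (K : MatchingMarket m n) (i : Fin m) (j : Fin n)
    (r : (Fin m → ℝ≥0) × (Fin n → ℝ≥0)) : Set (ℝ≥0 × ℝ≥0) :=
  {p | (i, j) ∈ K.bestMatching (Function.update r.1 i p.1) (Function.update r.2 j p.2)}

theorem measurableSet_matchRegion (i : Fin m) (j : Fin n)
    (r : (Fin m → ℝ≥0) × (Fin n → ℝ≥0)) : MeasurableSet (K.matchRegion i j r) :=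
  (((measurable_update r.1).comp measurable_fst).prodMk
    ((measurable_update r.2).comp measurable_snd)) (K.measurableSet_mem_bestMatching (i, j))

theorem matchRegion_closed {i : Fin m} {j : Fin n} {r : (Fin m → ℝ≥0) × (Fin n → ℝ≥0)}
    {v v' c c' : ℝ≥0} (h : (v, c) ∈ K.matchRegion i j r) (hv : v ≤ v') (hc : c' ≤ c) :
    (v', c') ∈ K.matchRegion i j r := by
  have h1 := bestMatching_update_value (t := v') h (by simpa using hv)
  rw [Function.update_idem] at h1
  have h2 : (i, j) ∈ K.bestMatching (Function.update r.1 i v') (Function.update r.2 j c) := by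
    rw [h1]
    exact h
  have h3 := bestMatching_update_cost (t := c') h2 (by simpa using hc)
  rw [Function.update_idem] at h3
  change (i, j) ∈ K.bestMatching (Function.update r.1 i v') (Function.update r.2 j c')
  rw [h3]
  exact h2

theorem cost_le_value_of_mem_matchRegion {i : Fin m} {j : Fin n}
    {r : (Fin m → ℝ≥0) × (Fin n → ℝ≥0)} {v c : ℝ≥0} (h : (v, c) ∈ K.matchRegion i j r) :
    c ≤ v := by
  simpa using cost_le_value_of_mem_bestMatching h

theorem lintegral_pairGain (i : Fin m) (j : Fin n) :
    ∫⁻ r, K.pairGain i j r ∂K.law =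
      ∫⁻ r, ∫⁻ p, (K.matchRegion i j r).indicator
        (fun p => ENNReal.ofReal ((p.1 : ℝ) - p.2)) p
          ∂((K.D i : Measure ℝ≥0).prod (K.F j : Measure ℝ≥0)) ∂K.law := by
  have hm : Measurable fun x : ((Fin m → ℝ≥0) × (Fin n → ℝ≥0)) × ℝ≥0 =>
      K.pairGain i j (Function.update x.1.1 i x.2, x.1.2) :=
    (measurable_pairGain i j).comp ((measurable_update'.comp
      (measurable_fst.fst.prodMk measurable_snd)).prodMk measurable_fst.snd)
  rw [lintegral_law_update_value K (measurable_pairGain i j) i,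
    lintegral_law_update_cost K hm.lintegral_prod_right' j]
  refine lintegral_congr fun r => ?_
  rw [lintegral_prod_symm]
  · refine lintegral_congr fun s => lintegral_congr fun t => ?_
    simp only [pairGain, matchRegion, indicator, mem_ofPred_eq, Function.update_self]
    congr
  · refine Measurable.aemeasurable (Measurable.indicator ?_ (measurableSet_matchRegion i j r))
    exact (measurable_fst.coe_nnreal_real.sub measurable_snd.coe_nnreal_real).ennreal_ofReal

theorem sellPairBound_update_cost (q : ℕ → ℝ≥0) (i : Fin m) (j : Fin n)
    (r : (Fin m → ℝ≥0) × (Fin n → ℝ≥0)) (s : ℝ≥0) :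
    K.sellPairBound q i j (r.1, Function.update r.2 j s) =
      sellerOffer (K.D i) q (K.matchRegion i j r) s := by
  simp only [sellPairBound, sellerOffer, matchRegion, indicator, mem_ofPred_eq,
    Function.update_self]
  refine iSup_congr fun k => ?_
  congr

theorem buyPairBound_update_value (q : ℕ → ℝ≥0) (i : Fin m) (j : Fin n)
    (r : (Fin m → ℝ≥0) × (Fin n → ℝ≥0)) (t : ℝ≥0) :
    K.buyPairBound q i j (Function.update r.1 i t, r.2) =
      buyerOffer (K.F j) q (K.matchRegion i j r) t := by
  simp only [buyPairBound, buyerOffer, matchRegion, indicator, mem_ofPred_eq,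
    Function.update_self]
  refine iSup_congr fun k => ?_
  congr

theorem lintegral_sellPairBound (q : ℕ → ℝ≥0) (i : Fin m) (j : Fin n) :
    ∫⁻ r, K.sellPairBound q i j r ∂K.law =
      ∫⁻ r, ∫⁻ s, sellerOffer (K.D i) q (K.matchRegion i j r) s ∂(K.F j) ∂K.law := by
  rw [lintegral_law_update_cost K (measurable_sellPairBound q i j) j]
  exact lintegral_congr fun r => lintegral_congr fun s => sellPairBound_update_cost q i j r s

theorem lintegral_buyPairBound (q : ℕ → ℝ≥0) (i : Fin m) (j : Fin n) :
    ∫⁻ r, K.buyPairBound q i j r ∂K.law =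
      ∫⁻ r, ∫⁻ t, buyerOffer (K.F j) q (K.matchRegion i j r) t ∂(K.D i) ∂K.law := by
  rw [lintegral_law_update_value K (measurable_buyPairBound q i j) i]
  exact lintegral_congr fun r => lintegral_congr fun t => buyPairBound_update_value q i j r t

theorem measurable_lintegral_sellerOffer (q : ℕ → ℝ≥0) (i : Fin m) (j : Fin n) :
    Measurable fun r => ∫⁻ s, sellerOffer (K.D i) q (K.matchRegion i j r) s ∂(K.F j) := by
  have hm : Measurable fun x : ((Fin m → ℝ≥0) × (Fin n → ℝ≥0)) × ℝ≥0 =>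
      K.sellPairBound q i j (x.1.1, Function.update x.1.2 j x.2) :=
    (measurable_sellPairBound q i j).comp (measurable_fst.fst.prodMk
      (measurable_update'.comp (measurable_fst.snd.prodMk measurable_snd)))
  convert hm.lintegral_prod_right' (ν := (K.F j : Measure ℝ≥0)) using 4 with r s
  exact (sellPairBound_update_cost q i j r s).symm

theorem measurable_lintegral_buyerOffer (q : ℕ → ℝ≥0) (i : Fin m) (j : Fin n) :
    Measurable fun r => ∫⁻ t, buyerOffer (K.F j) q (K.matchRegion i j r) t ∂(K.D i) := by
  have hm : Measurable fun x : ((Fin m → ℝ≥0) × (Fin n → ℝ≥0)) × ℝ≥0 =>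
      K.buyPairBound q i j (Function.update x.1.1 i x.2, x.1.2) :=
    (measurable_buyPairBound q i j).comp ((measurable_update'.comp
      (measurable_fst.fst.prodMk measurable_snd)).prodMk measurable_fst.snd)
  convert hm.lintegral_prod_right' (ν := (K.D i : Measure ℝ≥0)) using 4 with r t
  exact (buyPairBound_update_value q i j r t).symm

/-- The two-agent inequality for one pair of a buyer and a seller, averaged over all the other
values and costs. -/
theorem lintegral_pairGain_le {q : ℕ → ℝ≥0} (hD : ∀ i, IsPriceGrid q (K.D i : Measure ℝ≥0))
    (hF : ∀ j, IsPriceGrid q (K.F j : Measure ℝ≥0)) {l : ℝ} (hl : l ∈ Ioo (0 : ℝ) 1)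
    (i : Fin m) (j : Fin n) :
    (ENNReal.ofReal (1 - l) * ∫⁻ r, K.pairGain i j r ∂K.law ≤
      ∫⁻ r, K.sellPairBound q i j r ∂K.law +
        ENNReal.ofReal (Real.log (1 / l)) * ∫⁻ r, K.buyPairBound q i j r ∂K.law) ∧
    (ENNReal.ofReal (1 - l) * ∫⁻ r, K.pairGain i j r ∂K.law ≤
      ∫⁻ r, K.buyPairBound q i j r ∂K.law +
        ENNReal.ofReal (Real.log (1 / l)) * ∫⁻ r, K.sellPairBound q i j r ∂K.law) := by
  have key := fun r => lintegral_gain_le_offers (hD i) (hF j)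
    (measurableSet_matchRegion (K := K) i j r) matchRegion_closed
    cost_le_value_of_mem_matchRegion hl
  rw [lintegral_pairGain, lintegral_sellPairBound, lintegral_buyPairBound,
    ← lintegral_const_mul' _ _ ENNReal.ofReal_ne_top,
    ← lintegral_const_mul' _ _ ENNReal.ofReal_ne_top,
    ← lintegral_const_mul' _ _ ENNReal.ofReal_ne_top,
    ← lintegral_add_left (measurable_lintegral_sellerOffer q i j),
    ← lintegral_add_left (measurable_lintegral_buyerOffer q i j)]
  exact ⟨lintegral_mono fun r => (key r).1, lintegral_mono fun r => (key r).2⟩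

theorem firstBest_eq (K : MatchingMarket m n) :
    K.firstBest = ((∑ i, ∑ j, ∫⁻ r, K.pairGain i j r ∂K.law : ℝ≥0∞) : EReal) := by
  have hnn : ∀ (v : Fin m → ℝ≥0) (c : Fin n → ℝ≥0), ∀ e ∈ K.bestMatching v c,
      0 ≤ (v e.1 : ℝ) - c e.2 := fun v c e he =>
    sub_nonneg.2 (NNReal.coe_le_coe.2 (cost_le_value_of_mem_bestMatching he))
  have hsum : ∀ r : (Fin m → ℝ≥0) × (Fin n → ℝ≥0),
      ENNReal.ofReal (gft (K.bestMatching r.1 r.2) r.1 r.2) = ∑ i, ∑ j, K.pairGain i j r :=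
    fun r => by
    rw [gft, ENNReal.ofReal_sum_of_nonneg (hnn r.1 r.2), ← Fintype.sum_prod_type']
    simp only [pairGain, Prod.mk.eta]
    rw [← Finset.sum_filter, Finset.filter_mem_eq_inter, Finset.univ_inter]
  have hint : ∫⁻ r, ENNReal.ofReal (gft (K.bestMatching r.1 r.2) r.1 r.2) ∂K.law =
      ∑ i, ∑ j, ∫⁻ r, K.pairGain i j r ∂K.law := by
    rw [lintegral_congr hsum, lintegral_finsetSum _ fun i _ => Finset.measurable_sum _ fun j _ =>
      measurable_pairGain i j]
    exact Finset.sum_congr rfl fun i _ =>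
      lintegral_finsetSum _ fun j _ => measurable_pairGain i j
  rw [← hint, firstBest]
  simp only [sup'_gft_eq]
  exact extExpectation_of_nonneg fun r => Finset.sum_nonneg (hnn r.1 r.2)

end MatchingMarket

theorem log_three_le : Real.log 3 ≤ 11 / 10 := by
  rw [Real.log_le_iff_le_exp (by norm_num)]
  have h1 : (3 : ℝ) ^ 10 ≤ Real.exp (11 / 10) ^ 10 := by
    rw [← Real.exp_nat_mul]
    have : ((10 : ℕ) : ℝ) * (11 / 10) = (11 : ℕ) * 1 := by norm_num
    rw [this, Real.exp_nat_mul]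
    calc (3 : ℝ) ^ 10 ≤ 2.718 ^ 11 := by norm_num
      _ ≤ _ := by
        gcongr
        exact (by norm_num : (2.718 : ℝ) ≤ 2.7182818283).trans Real.exp_one_gt_d9.le
  exact le_of_pow_le_pow_left₀ (by norm_num) (Real.exp_pos _).le h1

theorem mainTheorem2 {m n : ℕ} (K : MatchingMarket m n) :
    (((1 / 3.15 : ℝ) : EReal) * K.firstBest ≤
      ((1 / 2 : ℝ) : EReal) * K.optSellersProfit + ((1 / 2 : ℝ) : EReal) * K.optBuyersProfit) ∧
    ∀ G H : MatchingMarket.Mechanism K, G.IsGSOM → H.IsGBOM →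
      ((1 / 3.15 : ℝ) : EReal) * K.firstBest ≤
        ((1 / 2 : ℝ) : EReal) * G.sellersProfit + ((1 / 2 : ℝ) : EReal) * H.buyersProfit := by
  have main : ((1 / 3.15 : ℝ) : EReal) * K.firstBest ≤
      ((1 / 2 : ℝ) : EReal) * K.optSellersProfit +
        ((1 / 2 : ℝ) : EReal) * K.optBuyersProfit := by
    obtain ⟨q, hq⟩ := exists_isPriceGrid (fun x : Fin m ⊕ Fin n =>
      ((Sum.elim K.D K.F x : ProbabilityMeasure ℝ≥0) : Measure ℝ≥0))
    set X : ℝ≥0∞ := ∑ i, ∑ j, ∫⁻ r, K.sellPairBound q i j r ∂K.law with hX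
    set Y : ℝ≥0∞ := ∑ i, ∑ j, ∫⁻ r, K.buyPairBound q i j r ∂K.law with hY
    set G : ℝ≥0∞ := ∑ i, ∑ j, ∫⁻ r, K.pairGain i j r ∂K.law with hG
    have hXle : (X : EReal) ≤ K.optSellersProfit := by
      refine le_trans ?_ (K.sum_lintegral_iSup_sellScore_le q)
      rw [EReal.coe_ennreal_le_coe_ennreal_iff]
      refine Finset.sum_le_sum fun i _ => ?_
      rw [← lintegral_finsetSum _ fun j _ => MatchingMarket.measurable_sellPairBound q i j]
      exact lintegral_mono fun r => MatchingMarket.sum_sellPairBound_le q i r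
    have hYle : (Y : EReal) ≤ K.optBuyersProfit := by
      refine le_trans ?_ (K.sum_lintegral_iSup_buyScore_le q)
      rw [EReal.coe_ennreal_le_coe_ennreal_iff, hY, Finset.sum_comm]
      refine Finset.sum_le_sum fun j _ => ?_
      rw [← lintegral_finsetSum _ fun i _ => MatchingMarket.measurable_buyPairBound q i j]
      exact lintegral_mono fun r => MatchingMarket.sum_buyPairBound_le q j r
    have hl : (1 / 3 : ℝ) ∈ Ioo (0 : ℝ) 1 := ⟨by norm_num, by norm_num⟩
    have hpair := MatchingMarket.lintegral_pairGain_le (K := K) (q := q)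
      (fun i => hq (Sum.inl i)) (fun j => hq (Sum.inr j)) hl
    have hlog : ENNReal.ofReal (Real.log (1 / (1 / 3))) ≤ ENNReal.ofReal (11 / 10) := by
      refine ENNReal.ofReal_le_ofReal ?_
      rw [one_div_one_div]
      exact log_three_le
    have h1 : ENNReal.ofReal (1 - 1 / 3) * G ≤ X + ENNReal.ofReal (11 / 10) * Y := by
      simp only [hG, hX, hY, Finset.mul_sum, ← Finset.sum_add_distrib]
      refine Finset.sum_le_sum fun i _ => Finset.sum_le_sum fun j _ => (hpair i j).1.trans ?_
      gcongr
    have h2 : ENNReal.ofReal (1 - 1 / 3) * G ≤ Y + ENNReal.ofReal (11 / 10) * X := by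
      simp only [hG, hX, hY, Finset.mul_sum, ← Finset.sum_add_distrib]
      refine Finset.sum_le_sum fun i _ => Finset.sum_le_sum fun j _ => (hpair i j).2.trans ?_
      gcongr
    have h3 : ENNReal.ofReal (1 / 3.15) * G ≤
        ENNReal.ofReal (1 / 2) * X + ENNReal.ofReal (1 / 2) * Y := by
      -- the sum of the two inequalities reads `4/3 * G ≤ 2.1 * (X + Y)`
      have h4 := mul_le_mul_right (add_le_add h1 h2) (ENNReal.ofReal (1 / 4.2))
      have e1 : ENNReal.ofReal (1 / 4.2) *
          (ENNReal.ofReal (1 - 1 / 3) * G + ENNReal.ofReal (1 - 1 / 3) * G) =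
          ENNReal.ofReal (1 / 3.15) * G := by
        rw [← add_mul, ← mul_assoc, ← ENNReal.ofReal_add (by norm_num) (by norm_num),
          ← ENNReal.ofReal_mul (by norm_num)]
        norm_num
      have e2 : ENNReal.ofReal (1 / 4.2) * (X + ENNReal.ofReal (11 / 10) * Y +
          (Y + ENNReal.ofReal (11 / 10) * X)) =
          ENNReal.ofReal (1 / 2) * X + ENNReal.ofReal (1 / 2) * Y := by
        have e3 : ENNReal.ofReal (1 / 2) =
            ENNReal.ofReal (1 / 4.2) * (1 + ENNReal.ofReal (11 / 10)) := by
          rw [← ENNReal.ofReal_one, ← ENNReal.ofReal_add (by norm_num) (by norm_num),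
            ← ENNReal.ofReal_mul (by norm_num)]
          norm_num
        rw [e3]
        ring
      rwa [e1, e2] at h4
    rw [K.firstBest_eq]
    have hc : ∀ x : ℝ, 0 ≤ x → (x : EReal) = ((ENNReal.ofReal x : ℝ≥0∞) : EReal) := fun x hx => by
      rw [EReal.coe_ennreal_ofReal, max_eq_left hx]
    calc ((1 / 3.15 : ℝ) : EReal) * (G : EReal)
        = ((ENNReal.ofReal (1 / 3.15) * G : ℝ≥0∞) : EReal) := by
          rw [hc _ (by norm_num), EReal.coe_ennreal_mul]
      _ ≤ ((ENNReal.ofReal (1 / 2) * X + ENNReal.ofReal (1 / 2) * Y : ℝ≥0∞) : EReal) :=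
          EReal.coe_ennreal_le_coe_ennreal_iff.2 h3
      _ = ((1 / 2 : ℝ) : EReal) * X + ((1 / 2 : ℝ) : EReal) * Y := by
          rw [hc _ (by norm_num), EReal.coe_ennreal_add, EReal.coe_ennreal_mul,
            EReal.coe_ennreal_mul]
      _ ≤ _ := by
          have hhalf : (0 : EReal) ≤ ((1 / 2 : ℝ) : EReal) := by
            exact_mod_cast (by norm_num : (0 : ℝ) ≤ 1 / 2)
          exact add_le_add (mul_le_mul_of_nonneg_left hXle hhalf)
            (mul_le_mul_of_nonneg_left hYle hhalf)
  refine ⟨main, fun G H hG hH => main.trans ?_⟩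
  have hhalf : (0 : EReal) ≤ ((1 / 2 : ℝ) : EReal) := by
    exact_mod_cast (by norm_num : (0 : ℝ) ≤ 1 / 2)
  refine add_le_add (mul_le_mul_of_nonneg_left (sSup_le ?_) hhalf)
    (mul_le_mul_of_nonneg_left (sSup_le ?_) hhalf)
  · rintro _ ⟨Z, h1, h2, rfl⟩
    exact hG.2 Z h1 h2
  · rintro _ ⟨Z, h1, h2, rfl⟩
    exact hH.2 Z h1 h2
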